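/- **Setting.** Let $k$ be a field. A local operator-system $(\mathcal D,\bar\epsilon)$ is a local finite-dimensional $k$-algebra $\mathcal D$ with maximal ideal $\mathfrak m$ and residue field $k$, with a $k$-basis $\bar\epsilon=(\epsilon_0=1,\epsilon_1,\dots,\epsilon_m)$ whose consecutive blocks give bases of $\mathfrak m^i/\mathfrak m^{i+1}$, $i\ge 0$. Put $\mathcal D(R)=\mathcal D\otimes_k R$. A $\mathcal D$-ring is a $k$-algebra $R$ with a $k$-algebra homomorphism $e:R\to\mathcal D(R)$ whose composite with the residue map $\mathcal D(R)\to R$ is the identity; write $e(a)=1\otimes a+\sum_{i=1}^m\epsilon_i\otimes\partial_i(a)$. Let $\alpha_i^{pq}\in k$ be the coefficient of $\epsilon_i$ in $\epsilon_p\epsilon_q$. Homomorphisms $\varphi$ of $\mathcal D$-rings satisfy $\mathcal D(\varphi)e=e'\varphi$; a $\mathcal D$-algebra over $R$ is an $R$-algebra whose structure map is such a homomorphism. Fix a pair $\underline{\mathcal D}=\{(\mathcal D_1,\bar\epsilon_1),(\mathcal D_2,\bar\epsilon_2)\}$ of local operator-systems with $\dim_k\mathcal D_u=m_u+1$. A $\underline{\mathcal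 D}$-ring is a $k$-algebra with a $\mathcal D_1$- and a $\mathcal D_2$-structure $\underline e=(e_1,e_2)$; the operators are $\partial_{u,i}$, $u\in\{1,2\}$, $1\le i\le m_u$. Let $(F,\underline e)$ be a $\underline{\mathcal D}$-field. A commutation system of Lie–Hasse–Schmidt type is a pair $\Gamma=\{r_1,r_2\}$ of $k$-algebra homomorphisms $r_u:\mathcal D_u\to\mathcal D_u\otimes_k\mathcal D_u(F)$ such that, for some (unique) coefficients $c_{u,\ell}^{ij}\in F$, $$r_1(\epsilon_{1,\ell})=1\otimes\epsilon_{1,\ell}+\sum_{i,j}\epsilon_{1,i}\otimes\epsilon_{1,j}\otimes c_{1,\ell}^{ji},\qquad r_2(\epsilon_{2,\ell})=\epsilon_{2,\ell}\otimes1+1\otimes\epsilon_{2,\ell}+\sum_{i,j}\epsilon_{2,i}\otimes\epsilon_{2,j}\otimes c_{2,\ell}^{ji},$$ where $c_{1,\ell}^{ji}=0$ unless $\epsilon_{1,i}\mathfrak m_1=\epsilon_{1,j}\mathfrak m_1=0$. A $\underline{\mathcal D}$-algebra $R$ over $F$ is a $\underline{\mathcal D}^\Gamma$-ring if $$\mathcal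 D_1(e_1)e_1=r_1^{e_1}e_1,\qquad \mathcal D_2(e_2)e_2=r_2^{\iota}e_2,\qquad \mathcal D_1(e_2)e_1=r_{12}^{e_1}e_2,$$ where $r_{12}(a)=1\otimes a\otimes 1$, $r^{\iota}$ is the $R$-linear extension of $r$ for the standard $R$-algebra structure on the target, and $r^{e_1}$ the one for the structure $R\to\mathcal D_1(R)\to\mathcal D_1(\mathcal D_v(R))$ through $e_1$ ($v=1$ for $r_1$, $v=2$ for $r_{12}$). Equivalently, $[\partial_{1,i},\partial_{1,j}]=\sum_\ell c_{1,\ell}^{ij}\partial_{1,\ell}$, $\ \partial_{2,i}\partial_{2,j}=\sum_\ell c_{2,\ell}^{ij}\partial_{2,\ell}$, $\ [\partial_{1,i},\partial_{2,j}]=0$. $\Gamma$ is Jacobi-associative if the following hold. 1. (Index $u=1$ omitted, all $i,j,l,r$.) $c_\ell^{ij}=-c_\ell^{ji}$ and $c_\ell^{ii}=0$; $$\sum_\ell\bigl(c_\ell^{ij}c_r^{\ell l}+c_\ell^{li}c_r^{\ell j}+c_\ell^{jl}c_r^{\ell i}\bigr)=\partial_i(c_r^{jl})+\partial_l(c_r^{ij})+\partial_j(c_r^{li});$$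 and, with $A_{q,r}=\sum_p\bigl(\alpha_i^{pq}\partial_p(c_r^{jl})+\alpha_l^{pq}\partial_p(c_r^{ij})+\alpha_j^{pq}\partial_p(c_r^{li})\bigr)$, $A_{r,r}=0$ and $A_{q,r}+A_{r,q}=0$ for $q<r$. 2. (Index $u=2$ omitted, all $i,j,l,r$.) $\sum_\ell\bigl(c_\ell^{ij}c_r^{\ell l}-c_\ell^{jl}c_r^{i\ell}-\sum_{p,q}\alpha_i^{pq}\partial_p(c_\ell^{jl})c_r^{q\ell}\bigr)=\partial_i(c_r^{jl})$. 3. $\partial_{u,l}(c_{v,r}^{ij})=0$ for $u\ne v$ and all $l,i,j,r$. Let $\mathfrak d=\{(u,i)\}$ be ordered by $(2,1)<\dots<(2,m_2)<(1,1)<\dots<(1,m_1)$, and let $\mathbb N^{\mathfrak d}_{<\infty}$ be the set of finite tuples $\xi=(i_1\ge\dots\ge i_s)$ in $\mathfrak d$ (including the empty one) with at most one entry of the form $(2,i)$; put $\partial_\xi=\partial_{i_1}\cdots\partial_{i_s}$. **Theorem.** Let $\Gamma$ be Jacobi-associative and let $(K,\underline e)$ be a $\underline{\mathcal D}^\Gamma$-field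 over $(F,\underline e)$. (a) If $x$ (in some field extension of $K$) is transcendental over $K$, there is a $\underline{\mathcal D}^\Gamma$-field $L$ extending $(K,\underline e)$ and containing $K(x)$ (up to a $K$-embedding), generated over $K$ as a $\underline{\mathcal D}$-field by $x$, such that - the family $(\partial_\xi x)_{\xi\in\mathbb N^{\mathfrak d}_{<\infty}}$ is algebraically independent over $K$; - the operators $\partial_{u,i}$ ($u\in\{1,2\}$), $\partial_{1,i}\partial_{1,j}$ ($i\le j$) and $\partial_{1,i}\partial_{2,j}$, taken together, are $F$-linearly independent as functions $L\to L$; - the $\underline{\mathcal D}$-algebra $K[x]_{\underline{\mathcal D}^\Gamma}$ over $K$ generated by $x$ in $L$ is the $\underline{\mathcal D}^\Gamma$-polynomial ring in one variable over $K$: with the restricted structure it is a $\underline{\mathcal D}^\Gamma$-algebra over $(K,\underline e)$, and for every $\underline{\mathcal D}^\Gamma$-algebra $A$ over $(K,\underline e)$ and every $a\in A$ there is exactly one $\underline{\mathcal D}$-homomorphism $K[x]_{\underline{\mathcal D}^\Gamma}\to A$ over $K$ with $x\mapsto a$. (b) For every $n\ge 0$ there is a $\underline{\mathcal D}^\Gamma$-field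 $L$ extending $(K,\underline e)$, generated over $K$ as a $\underline{\mathcal D}$-field by a tuple $(x_1,\dots,x_n)$, such that the family $(\partial_\xi x_t)_{1\le t\le n,\ \xi\in\mathbb N^{\mathfrak d}_{<\infty}}$ is algebraically independent over $K$ and the $\underline{\mathcal D}$-algebra over $K$ generated by $x_1,\dots,x_n$ in $L$ is the $\underline{\mathcal D}^\Gamma$-polynomial ring in $n$ variables over $K$, i.e. has the analogous universal property for $n$-tuples $(a_1,\dots,a_n)$ in $A$. -/

import Mathlib

open scoped TensorProduct IntermediateField

universe u v w u₁ u₂ u₃ u₄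

noncomputable section

/-! ### Local operator-systems -/

section OperatorSystem

variable (k : Type*) [Field k] (D : Type*) [CommRing D] [Algebra k D] [IsLocalRing D]

/-- The `k`-vector space `𝔪 ^ i / 𝔪 ^ (i + 1)`, where `𝔪` is the maximal ideal of `D`. -/
abbrev GradedPiece (i : ℕ) : Type _ :=
  ↥((IsLocalRing.maximalIdeal D ^ i).restrictScalars k) ⧸
    ((IsLocalRing.maximalIdeal D ^ (i + 1)).restrictScalars k).submoduleOf
      ((IsLocalRing.maximalIdeal D ^ i).restrictScalars k)

/-- The sum of the dimensions of `𝔪 ^ j / 𝔪 ^ (j + 1)` over `j < i`. -/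
def gradedOffset (i : ℕ) : ℕ :=
  ∑ j ∈ Finset.range i, Module.finrank k (GradedPiece k D j)

/-- A local operator-system: a finite dimensional local `k`-algebra `D` with residue field `k`,
together with a ranked basis `(ε 0 = 1, ε 1, …, ε m)`, i.e. one whose consecutive blocks yield
bases of the successive quotients `𝔪 ^ i / 𝔪 ^ (i + 1)`. (For large `i` the quotient is zero and
the block is empty.) -/
structure LocalOperatorSystem where
  /-- the number of operators, so that `dim D = m + 1` -/
  m : ℕ
  /-- the ranked basis -/
  ε : Module.Basis (Fin (m + 1)) k D
  residue_bijective : Function.Bijective (algebraMap k (IsLocalRing.ResidueField D))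
  ε_zero : ε 0 = 1
  ranked : ∀ i : ℕ, ∃ b : Module.Basis
      {p : Fin (m + 1) // gradedOffset k D i ≤ p.1 ∧ p.1 < gradedOffset k D (i + 1)} k
      (GradedPiece k D i),
    ∀ p, ∃ h : ε p.1 ∈ (IsLocalRing.maximalIdeal D ^ i).restrictScalars k,
      b p = Submodule.Quotient.mk ⟨ε p.1, h⟩

end OperatorSystem

namespace LocalOperatorSystem

variable {k : Type*} [Field k] {D : Type*} [CommRing D] [Algebra k D] [IsLocalRing D]

/-- The residue map `π : D → k`. -/
def π (𝒟 : LocalOperatorSystem k D) : D →ₐ[k] k :=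
  ((AlgEquiv.ofBijective (Algebra.ofId k (IsLocalRing.ResidueField D))
    𝒟.residue_bijective).symm : IsLocalRing.ResidueField D →ₐ[k] k).comp
    (IsScalarTower.toAlgHom k D (IsLocalRing.ResidueField D))

/-- The base change `π^R : D ⊗ R → R` of the residue map. -/
def πBase (𝒟 : LocalOperatorSystem k D) (R : Type*) [CommRing R] [Algebra k R] :
    D ⊗[k] R →ₐ[k] R :=
  (Algebra.TensorProduct.lid k R : k ⊗[k] R →ₐ[k] R).comp
    (Algebra.TensorProduct.map 𝒟.π (AlgHom.id k R))

/-- The non-unit elements `ε_1, …, ε_m` of the ranked basis, indexed by `Fin m`. -/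
def eps (𝒟 : LocalOperatorSystem k D) (i : Fin 𝒟.m) : D := 𝒟.ε i.succ

/-- `α i p q` is the coefficient of `ε_i` in the product `ε_p * ε_q`. -/
def α (𝒟 : LocalOperatorSystem k D) (i p q : Fin 𝒟.m) : k :=
  𝒟.ε.repr (𝒟.eps p * 𝒟.eps q) i.succ

/-- The null of `D`: those `q` with `ε_q * 𝔪 = 0`. -/
def Null (𝒟 : LocalOperatorSystem k D) : Set (Fin 𝒟.m) :=
  {q | ∀ a ∈ IsLocalRing.maximalIdeal D, 𝒟.eps q * a = 0}

end LocalOperatorSystem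

/-! ### Rings with operators -/

/-- The lift `D ⊗ R → D ⊗ S` of a `k`-algebra homomorphism `R → S`. -/
abbrev baseMap {k : Type*} [Field k] (D : Type*) [CommRing D] [Algebra k D]
    {R S : Type*} [CommRing R] [Algebra k R] [CommRing S] [Algebra k S] (φ : R →ₐ[k] S) :
    D ⊗[k] R →ₐ[k] D ⊗[k] S :=
  Algebra.TensorProduct.map (AlgHom.id k D) φ

/-- A `𝒟`-ring structure on the `k`-algebra `R`: a `k`-algebra homomorphism `e : R → D ⊗ R`
with `π^R ∘ e = id`. -/
structure OperatorStructure {k : Type*} [Field k] {D : Type*} [CommRing D] [Algebra k D]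
    [IsLocalRing D] (𝒟 : LocalOperatorSystem k D) (R : Type*) [CommRing R] [Algebra k R] where
  /-- the underlying homomorphism -/
  e : R →ₐ[k] D ⊗[k] R
  residue_comp : (𝒟.πBase R).comp e = AlgHom.id k R

/-- The operators `∂_1, …, ∂_m` of a `𝒟`-ring:
`e x = 1 ⊗ x + ε_1 ⊗ ∂_1 x + ⋯ + ε_m ⊗ ∂_m x`. -/
def OperatorStructure.del {k : Type*} [Field k] {D : Type*} [CommRing D] [Algebra k D]
    [IsLocalRing D] {𝒟 : LocalOperatorSystem k D} {R : Type*} [CommRing R] [Algebra k R]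
    (E : OperatorStructure 𝒟 R) (i : Fin 𝒟.m) (x : R) : R :=
  TensorProduct.lid k R ((𝒟.ε.coord i.succ).rTensor R (E.e x))

section Pair

variable {k : Type*} [Field k]
  {D₁ : Type*} [CommRing D₁] [Algebra k D₁] [IsLocalRing D₁]
  {D₂ : Type*} [CommRing D₂] [Algebra k D₂] [IsLocalRing D₂]

/-- A `𝒟`-ring structure on `R` for the pair `𝒟 = {𝒟₁, 𝒟₂}` of local operator-systems. -/
structure PairStructure (𝒟₁ : LocalOperatorSystem k D₁) (𝒟₂ : LocalOperatorSystem k D₂)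
    (R : Type*) [CommRing R] [Algebra k R] where
  /-- the `𝒟₁`-structure (Lie-type operators) -/
  fst : OperatorStructure 𝒟₁ R
  /-- the `𝒟₂`-structure (HS-type operators) -/
  snd : OperatorStructure 𝒟₂ R

/-- The index set `𝔡` of all operators with its order
`(2,1) < ⋯ < (2,m₂) < (1,1) < ⋯ < (1,m₁)`: the left summand indexes the operators of `𝒟₂`
(HS-type), the right one those of `𝒟₁` (Lie-type). -/
abbrev OpIndex (𝒟₁ : LocalOperatorSystem k D₁) (𝒟₂ : LocalOperatorSystem k D₂) : Type :=
  Fin 𝒟₂.m ⊕ₗ Fin 𝒟₁.m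

/-- The set `ℕ^𝔡_{<∞}`: weakly decreasing finite tuples in `𝔡` with at most one entry of
HS-type. -/
def OrderedIndex (𝒟₁ : LocalOperatorSystem k D₁) (𝒟₂ : LocalOperatorSystem k D₂) : Type :=
  {ξ : List (OpIndex 𝒟₁ 𝒟₂) //
    ξ.Pairwise (fun i j => i ≥ j) ∧ ξ.countP (fun i => (ofLex i).isLeft) ≤ 1}

variable {𝒟₁ : LocalOperatorSystem k D₁} {𝒟₂ : LocalOperatorSystem k D₂}

namespace PairStructure

variable {R : Type*} [CommRing R] [Algebra k R]

/-- The operator `∂_i` for `i ∈ 𝔡`. -/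
def op (E : PairStructure 𝒟₁ 𝒟₂ R) (i : OpIndex 𝒟₁ 𝒟₂) : R → R :=
  Sum.elim (fun j => E.snd.del j) (fun j => E.fst.del j) (ofLex i)

/-- The iterate `∂_ξ = ∂_{i_1} ⋯ ∂_{i_s}` for `ξ = (i_1, …, i_s)`. -/
def iter (E : PairStructure 𝒟₁ 𝒟₂ R) (ξ : List (OpIndex 𝒟₁ 𝒟₂)) (x : R) : R :=
  ξ.foldr (fun i y => E.op i y) x

/-- `φ : R → S` is a `𝒟`-homomorphism. -/
def IsHom {S : Type*} [CommRing S] [Algebra k S] (E : PairStructure 𝒟₁ 𝒟₂ R)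
    (E' : PairStructure 𝒟₁ 𝒟₂ S) (φ : R →ₐ[k] S) : Prop :=
  (baseMap D₁ φ).comp E.fst.e = E'.fst.e.comp φ ∧
  (baseMap D₂ φ).comp E.snd.e = E'.snd.e.comp φ

/-- `(S, E')` is a `𝒟`-algebra over `(R, E)`: the structure map is a `𝒟`-homomorphism. -/
def IsAlgebraOver {S : Type*} [CommRing S] [Algebra k S] [Algebra R S] [IsScalarTower k R S]
    (E : PairStructure 𝒟₁ 𝒟₂ R) (E' : PairStructure 𝒟₁ 𝒟₂ S) : Prop :=
  E.IsHom E' (IsScalarTower.toAlgHom k R S)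

/-- The `𝒟`-algebra over `K` generated by the set `X` inside the `𝒟`-ring `S`: the smallest
`K`-subalgebra that contains `X` and is closed under all the operators. -/
def algebraAdjoin (K : Type*) [Field K] [Algebra K R] (E : PairStructure 𝒟₁ 𝒟₂ R) (X : Set R) :
    Subalgebra K R :=
  sInf {S | X ⊆ S ∧ ∀ i, ∀ a ∈ S, E.op i a ∈ S}

/-- The `𝒟`-field over `K` generated by the set `X` inside the `𝒟`-field `L`: the smallest
subfield that contains `K` and `X` and is closed under all the operators. -/
def fieldAdjoin (K : Type*) [Field K] {L : Type*} [Field L] [Algebra k L] [Algebra K L]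
    (E : PairStructure 𝒟₁ 𝒟₂ L) (X : Set L) : IntermediateField K L :=
  sInf {M | X ⊆ M ∧ ∀ i, ∀ a ∈ M, E.op i a ∈ M}

end PairStructure

end Pair

/-! ### Commutation -/

section Commutation

variable {k : Type*} [Field k]
  {D₁ : Type*} [CommRing D₁] [Algebra k D₁] [IsLocalRing D₁]
  {D₂ : Type*} [CommRing D₂] [Algebra k D₂] [IsLocalRing D₂]
  {𝒟₁ : LocalOperatorSystem k D₁} {𝒟₂ : LocalOperatorSystem k D₂}
  {F : Type*} [Field F] [Algebra k F]
  {R : Type*} [CommRing R] [Algebra k R] [Algebra F R] [IsScalarTower k F R]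

/-- The lift `D₂ ⊗ R → D₁ ⊗ (D₂ ⊗ R)` of `r : D₂ → D₁ ⊗ (D₂ ⊗ F)` which on `R` is the given
homomorphism `g : R → D₁ ⊗ (D₂ ⊗ R)`. -/
def liftAlong (r : D₂ →ₐ[k] D₁ ⊗[k] (D₂ ⊗[k] F)) (g : R →ₐ[k] D₁ ⊗[k] (D₂ ⊗[k] R)) :
    D₂ ⊗[k] R →ₐ[k] D₁ ⊗[k] (D₂ ⊗[k] R) :=
  Algebra.TensorProduct.productMap
    ((baseMap D₁ (baseMap D₂ (IsScalarTower.toAlgHom k F R))).comp r) g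

/-- The lift `r^ι`, with respect to the standard structure `a ↦ 1 ⊗ 1 ⊗ a`. -/
def liftStandard (r : D₂ →ₐ[k] D₁ ⊗[k] (D₂ ⊗[k] F)) :
    D₂ ⊗[k] R →ₐ[k] D₁ ⊗[k] (D₂ ⊗[k] R) :=
  liftAlong r
    ((Algebra.TensorProduct.includeRight : D₂ ⊗[k] R →ₐ[k] D₁ ⊗[k] (D₂ ⊗[k] R)).comp
      (Algebra.TensorProduct.includeRight : R →ₐ[k] D₂ ⊗[k] R))

/-- The lift `r^{e₁}`, with respect to the structure `R → D₁ ⊗ R → D₁ ⊗ (D₂ ⊗ R)` given by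
`e₁`. -/
def liftTwisted (r : D₂ →ₐ[k] D₁ ⊗[k] (D₂ ⊗[k] F)) (e₁ : R →ₐ[k] D₁ ⊗[k] R) :
    D₂ ⊗[k] R →ₐ[k] D₁ ⊗[k] (D₂ ⊗[k] R) :=
  liftAlong r
    ((baseMap D₁ (Algebra.TensorProduct.includeRight : R →ₐ[k] D₂ ⊗[k] R)).comp e₁)

/-- `(e₁, e₂)` commute on `R` with respect to the lift `ρ` of some `r`:
`D₁(e₂) ∘ e₁ = ρ ∘ e₂`. -/
def CommuteWrt (e₁ : R →ₐ[k] D₁ ⊗[k] R) (e₂ : R →ₐ[k] D₂ ⊗[k] R)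
    (ρ : D₂ ⊗[k] R →ₐ[k] D₁ ⊗[k] (D₂ ⊗[k] R)) : Prop :=
  (baseMap D₁ e₂).comp e₁ = ρ.comp e₂

/-- The canonical embedding `D₂ → D₁ ⊗ (D₂ ⊗ F)`, `x ↦ 1 ⊗ (x ⊗ 1)`. -/
def canonicalEmbedding (k : Type*) [Field k] (D₁ : Type*) [CommRing D₁] [Algebra k D₁]
    (D₂ : Type*) [CommRing D₂] [Algebra k D₂] (F : Type*) [Field F] [Algebra k F] :
    D₂ →ₐ[k] D₁ ⊗[k] (D₂ ⊗[k] F) :=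
  (Algebra.TensorProduct.includeRight : D₂ ⊗[k] F →ₐ[k] D₁ ⊗[k] (D₂ ⊗[k] F)).comp
    (Algebra.TensorProduct.includeLeft : D₂ →ₐ[k] D₂ ⊗[k] F)

/-- `r` is of Lie-commutation type with Lie-coefficients `c`, where `c ℓ i j` stands for
`c_ℓ^{ij}`. -/
def IsLieType {D : Type*} [CommRing D] [Algebra k D] [IsLocalRing D]
    (𝒟 : LocalOperatorSystem k D) (r : D →ₐ[k] D ⊗[k] (D ⊗[k] F))
    (c : Fin 𝒟.m → Fin 𝒟.m → Fin 𝒟.m → F) : Prop :=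
  (∀ ℓ, r (𝒟.eps ℓ) = 1 ⊗ₜ[k] (𝒟.eps ℓ ⊗ₜ[k] 1)
    + ∑ i, ∑ j, 𝒟.eps i ⊗ₜ[k] (𝒟.eps j ⊗ₜ[k] c ℓ j i)) ∧
  ∀ ℓ i j, ¬ (i ∈ 𝒟.Null ∧ j ∈ 𝒟.Null) → c ℓ j i = 0

/-- `r` is of Hasse-Schmidt-iteration type with HS-coefficients `c`, where `c ℓ i j` stands for
`c_ℓ^{ij}`. As for the Lie type, `c_ℓ^{ji}` is the coefficient at `ε_i ⊗ ε_j`, because the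
coefficient of `D(e)(e(a))` at `ε_i ⊗ ε_j` is `∂_j ∂_i a`; thus commutation with respect to `r^ι`
says `∂_i ∂_j = ∑ c_ℓ^{ij} ∂_ℓ`. -/
def IsHSType {D : Type*} [CommRing D] [Algebra k D] [IsLocalRing D]
    (𝒟 : LocalOperatorSystem k D) (r : D →ₐ[k] D ⊗[k] (D ⊗[k] F))
    (c : Fin 𝒟.m → Fin 𝒟.m → Fin 𝒟.m → F) : Prop :=
  ∀ ℓ, r (𝒟.eps ℓ) = 𝒟.eps ℓ ⊗ₜ[k] (1 ⊗ₜ[k] 1) + 1 ⊗ₜ[k] (𝒟.eps ℓ ⊗ₜ[k] 1)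
    + ∑ i, ∑ j, 𝒟.eps i ⊗ₜ[k] (𝒟.eps j ⊗ₜ[k] c ℓ j i)

/-- A commutation system of Lie-Hasse-Schmidt type for `{𝒟₁, 𝒟₂}` over `F`, with its
(uniquely determined) coefficients. -/
structure LHSSystem (𝒟₁ : LocalOperatorSystem k D₁) (𝒟₂ : LocalOperatorSystem k D₂)
    (F : Type*) [Field F] [Algebra k F] where
  /-- the homomorphism of Lie-commutation type -/
  r₁ : D₁ →ₐ[k] D₁ ⊗[k] (D₁ ⊗[k] F)
  /-- the homomorphism of HS-iteration type -/
  r₂ : D₂ →ₐ[k] D₂ ⊗[k] (D₂ ⊗[k] F)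
  /-- the Lie-coefficients of `r₁` -/
  c₁ : Fin 𝒟₁.m → Fin 𝒟₁.m → Fin 𝒟₁.m → F
  /-- the HS-coefficients of `r₂` -/
  c₂ : Fin 𝒟₂.m → Fin 𝒟₂.m → Fin 𝒟₂.m → F
  lie : IsLieType 𝒟₁ r₁ c₁
  hs : IsHSType 𝒟₂ r₂ c₂

/-- `(R, E)` has `Γ`-commuting operators: `e₁` commutes with respect to `r₁^{e₁}`, `e₂` commutes
with respect to `r₂^ι`, and `(e₁, e₂)` commute with respect to the `e₁`-lift of the canonical
embedding. -/
def LHSSystem.Commutes (Γ : LHSSystem 𝒟₁ 𝒟₂ F) (E : PairStructure 𝒟₁ 𝒟₂ R) : Prop :=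
  CommuteWrt E.fst.e E.fst.e (liftTwisted Γ.r₁ E.fst.e) ∧
  CommuteWrt E.snd.e E.snd.e (liftStandard Γ.r₂) ∧
  CommuteWrt E.fst.e E.snd.e (liftTwisted (canonicalEmbedding k D₁ D₂ F) E.fst.e)

/-- The Jacobi property for Lie-coefficients `c` over the `𝒟`-field `F`. Skew-symmetry includes
the vanishing of the diagonal, which matters in characteristic two only. -/
structure IsJacobi {D : Type*} [CommRing D] [Algebra k D] [IsLocalRing D]
    {𝒟 : LocalOperatorSystem k D} (E : OperatorStructure 𝒟 F)
    (c : Fin 𝒟.m → Fin 𝒟.m → Fin 𝒟.m → F) : Prop where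
  skew : ∀ ℓ i j, c ℓ i j = - c ℓ j i
  diag : ∀ ℓ i, c ℓ i i = 0
  jacobi : ∀ i j l r,
    ∑ ℓ, (c ℓ i j * c r ℓ l + c ℓ l i * c r ℓ j + c ℓ j l * c r ℓ i) =
      E.del i (c r j l) + E.del l (c r i j) + E.del j (c r l i)
  leibniz_diag : ∀ i j l r,
    ∑ p, (𝒟.α i p r • E.del p (c r j l) + 𝒟.α l p r • E.del p (c r i j)
      + 𝒟.α j p r • E.del p (c r l i)) = 0
  leibniz : ∀ i j l q r, q < r →
    ∑ p, (𝒟.α i p q • E.del p (c r j l) + 𝒟.α l p q • E.del p (c r i j)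
      + 𝒟.α j p q • E.del p (c r l i) + 𝒟.α i p r • E.del p (c q j l)
      + 𝒟.α l p r • E.del p (c q i j) + 𝒟.α j p r • E.del p (c q l i)) = 0

/-- The associativity property for HS-coefficients `c` over the `𝒟`-field `F`. -/
def IsAssociative {D : Type*} [CommRing D] [Algebra k D] [IsLocalRing D]
    {𝒟 : LocalOperatorSystem k D} (E : OperatorStructure 𝒟 F)
    (c : Fin 𝒟.m → Fin 𝒟.m → Fin 𝒟.m → F) : Prop :=
  ∀ i j l r,
    ∑ ℓ, (c ℓ i j * c r ℓ l - c ℓ j l * c r i ℓ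
      - ∑ p, ∑ q, 𝒟.α i p q • (E.del p (c ℓ j l) * c r q ℓ)) = E.del i (c r j l)

/-- `Γ` is Jacobi-associative over the `𝒟`-field `(F, E)`. -/
structure LHSSystem.IsJacobiAssociative (Γ : LHSSystem 𝒟₁ 𝒟₂ F) (E : PairStructure 𝒟₁ 𝒟₂ F) :
    Prop where
  jacobi : IsJacobi E.fst Γ.c₁
  assoc : IsAssociative E.snd Γ.c₂
  fst_const : ∀ l i j r, E.fst.del l (Γ.c₂ r i j) = 0
  snd_const : ∀ l i j r, E.snd.del l (Γ.c₁ r i j) = 0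

end Commutation

/-! ### Linear independence of operators, and polynomial rings -/

section Conclusions

variable {k : Type*} [Field k]
  {D₁ : Type*} [CommRing D₁] [Algebra k D₁] [IsLocalRing D₁]
  {D₂ : Type*} [CommRing D₂] [Algebra k D₂] [IsLocalRing D₂]
  {𝒟₁ : LocalOperatorSystem k D₁} {𝒟₂ : LocalOperatorSystem k D₂}

/-- The operators `∂_{u,i}`, the `∂_{1,i} ∂_{1,j}` with `i ≤ j`, and the `∂_{1,i} ∂_{2,j}`, as one
family of functions `R → R`. -/
def lowOperators {R : Type*} [CommRing R] [Algebra k R] (E : PairStructure 𝒟₁ 𝒟₂ R) :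
    (Fin 𝒟₁.m ⊕ Fin 𝒟₂.m) ⊕ {p : Fin 𝒟₁.m × Fin 𝒟₁.m // p.1 ≤ p.2} ⊕ (Fin 𝒟₁.m × Fin 𝒟₂.m) →
      (R → R)
  | Sum.inl (Sum.inl i) => E.fst.del i
  | Sum.inl (Sum.inr i) => E.snd.del i
  | Sum.inr (Sum.inl p) => E.fst.del p.1.1 ∘ E.fst.del p.1.2
  | Sum.inr (Sum.inr p) => E.fst.del p.1 ∘ E.snd.del p.2

/-- `(P, EP)` together with the tuple `x` is the `𝒟^Γ`-polynomial ring over `(K, EK)`: it is a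
`𝒟^Γ`-algebra over `(K, EK)`, and for all tuples `a` in `𝒟^Γ`-algebras `A` over `(K, EK)` there is
exactly one `𝒟`-homomorphism `P → A` over `K` that maps `x` to `a`. -/
def IsPolynomialRing {F : Type*} [Field F] [Algebra k F] (Γ : LHSSystem 𝒟₁ 𝒟₂ F)
    {K : Type*} [Field K] [Algebra k K] [Algebra F K] (EK : PairStructure 𝒟₁ 𝒟₂ K)
    {P : Type*} [CommRing P] [Algebra k P] [Algebra F P] [Algebra K P]
    [IsScalarTower k F P] [IsScalarTower k K P] (EP : PairStructure 𝒟₁ 𝒟₂ P)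
    {ι : Type*} (x : ι → P) : Prop :=
  EK.IsAlgebraOver EP ∧ Γ.Commutes EP ∧
  ∀ (A : Type w) [CommRing A] [Algebra k A] [Algebra F A] [Algebra K A]
    [IsScalarTower k F A] [IsScalarTower k K A] [IsScalarTower F K A]
    (EA : PairStructure 𝒟₁ 𝒟₂ A), EK.IsAlgebraOver EA → Γ.Commutes EA →
    ∀ a : ι → A, ∃! ψ : P →ₐ[K] A, EP.IsHom EA (ψ.restrictScalars k) ∧ ∀ t, ψ (x t) = a t

end Conclusions

end

noncomputable section

/-! ### The ranked basis -/

namespace LocalOperatorSystem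

variable {k : Type*} [Field k] {D : Type*} [CommRing D] [Algebra k D] [IsLocalRing D]

/-! The proof is a Poincaré–Birkhoff–Witt argument. Take the polynomial ring over `K` in one
variable for each `t`, each multiset `s` of Lie indices and at most one HS index `b`; the variable
stands for `∂_{1,s} ∂_{2,b} x_t`. An operator structure is an algebra homomorphism `e`, so on a
polynomial ring it may be prescribed freely on the variables. The relations dictate the
prescription. For HS operators, `∂_{2,j}` passes through `∂_{1,s}` and products are rewritten with
`c₂`. For Lie operators, `∂_i X_s = X_{is}` if `i` is at least every entry of `s`; otherwise `s =
ls'` with `l` maximal and `i < l`, and `∂_i X_s` is set to `∂_l ∂_i X_{s'} + ∑ c_ℓ^{il} ∂_ℓ X_{s'}`.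
The recursion makes sense because `∂_i X_s - X_{is}` has order at most `|s|`
(`lieCorrection_stable`).

It remains to see that all relations hold (`polyPair_commutesAt`). Each relation says that two
algebra homomorphisms agree, so it suffices to test variables, by induction on their order. If an
index dominates `s`, the relation is the definition. The one real overlap is `∂_i ∂_j ∂_l X_s` with
`i, j ≤ l` (`polyPair_lie_step`), which is resolved by the Jacobi identity for commutators
(`IsJacobi.cyclic`). The products in the twisted Leibniz rule add second-order terms there; they
cancel in pairs. Associativity settles the HS relation (`polyPair_hs`), and constancy of the
coefficients of each type under the other operators settles the mixed one.

Every variable is reached from `x_t` by an ordered iterate, so a homomorphism is determined by the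
images of the `x_t`; conversely the same induction shows that evaluation commutes with the operators
(`evalAt_fst`, `evalAt_snd`). The structure extends to the fraction field because `e p` is a unit
modulo nilpotents for `p ≠ 0`. Ordered iterates of the `x_t` are pairwise distinct variables, which
yields algebraic independence, and linear independence of the operators is read off at one generic
element. -/

theorem finrank_pow_maximalIdeal [FiniteDimensional k D] (i : ℕ) :
    Module.finrank k ↥((IsLocalRing.maximalIdeal D ^ i).restrictScalars k) =
      Module.finrank k (GradedPiece k D i) +
        Module.finrank k ↥((IsLocalRing.maximalIdeal D ^ (i + 1)).restrictScalars k) := by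
  have hle : (IsLocalRing.maximalIdeal D ^ (i + 1)).restrictScalars k ≤
      (IsLocalRing.maximalIdeal D ^ i).restrictScalars k :=
    fun x hx => Ideal.pow_le_pow_right (Nat.le_succ i) hx
  rw [← Submodule.finrank_quotient_add_finrank
    (((IsLocalRing.maximalIdeal D ^ (i + 1)).restrictScalars k).submoduleOf
      ((IsLocalRing.maximalIdeal D ^ i).restrictScalars k))]
  congr 1
  exact (Submodule.submoduleOfEquivOfLe hle).finrank_eq

/-- The dimensions of the graded pieces telescope. This locates the blocks of the ranked basis. -/
theorem gradedOffset_add_finrank [FiniteDimensional k D] (i : ℕ) :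
    gradedOffset k D i +
      Module.finrank k ↥((IsLocalRing.maximalIdeal D ^ i).restrictScalars k) =
        Module.finrank k D := by
  induction i with
  | zero =>
    have : (IsLocalRing.maximalIdeal D ^ 0).restrictScalars k = (⊤ : Submodule k D) := by
      ext x; simp
    rw [this, finrank_top]
    simp [gradedOffset]
  | succ i ih =>
    rw [← ih, finrank_pow_maximalIdeal i, gradedOffset, Finset.sum_range_succ, ← gradedOffset,
      add_assoc]

theorem finiteDimensional (𝒟 : LocalOperatorSystem k D) : FiniteDimensional k D :=
  Module.Basis.finiteDimensional_of_finite 𝒟.ε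

theorem exists_pow_maximalIdeal_eq_bot (𝒟 : LocalOperatorSystem k D) :
    ∃ N, IsLocalRing.maximalIdeal D ^ N = ⊥ := by
  have := 𝒟.finiteDimensional
  have : IsArtinianRing D := IsArtinianRing.of_finite k D
  exact IsArtinianRing.isNilpotent_jacobson_bot (R := D) |>.imp fun N h => by
    rwa [IsLocalRing.jacobson_eq_maximalIdeal ⊥ bot_ne_top] at h

theorem ker_π (𝒟 : LocalOperatorSystem k D) (x : D) :
    𝒟.π x = 0 ↔ x ∈ IsLocalRing.maximalIdeal D := by
  rw [← IsLocalRing.residue_eq_zero_iff]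
  simp only [π, AlgHom.comp_apply]
  exact map_eq_zero_iff _ (AlgEquiv.ofBijective (Algebra.ofId k (IsLocalRing.ResidueField D))
    𝒟.residue_bijective).symm.injective

theorem finrank_maximalIdeal (𝒟 : LocalOperatorSystem k D) :
    Module.finrank k ↥((IsLocalRing.maximalIdeal D ^ 1).restrictScalars k) + 1 =
      Module.finrank k D := by
  have := 𝒟.finiteDimensional
  have h := LinearMap.finrank_range_add_finrank_ker 𝒟.π.toLinearMap
  have hs : Function.Surjective 𝒟.π.toLinearMap := fun a => ⟨algebraMap k D a, by simp⟩
  rw [LinearMap.range_eq_top.2 hs, finrank_top, Module.finrank_self, add_comm] at h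
  rw [← h]
  have : LinearMap.ker 𝒟.π.toLinearMap =
      (IsLocalRing.maximalIdeal D ^ 1).restrictScalars k := by
    ext x; simp [ker_π]
  rw [this]

theorem gradedOffset_one (𝒟 : LocalOperatorSystem k D) : gradedOffset k D 1 = 1 := by
  have := 𝒟.finiteDimensional
  have h1 := gradedOffset_add_finrank (k := k) (D := D) 1
  have h2 := 𝒟.finrank_maximalIdeal
  omega

/-- Since `𝔪 ^ N = 0` for some `N`, the blocks exhaust the basis. The block of degree zero has
length one, as the residue field is `k`, so it is `ε_0` alone and every other basis element lies in
a block of positive degree. -/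
theorem eps_mem (𝒟 : LocalOperatorSystem k D) (i : Fin 𝒟.m) :
    𝒟.eps i ∈ IsLocalRing.maximalIdeal D := by
  have := 𝒟.finiteDimensional
  obtain ⟨N, hN⟩ := 𝒟.exists_pow_maximalIdeal_eq_bot
  have hdim : Module.finrank k D = 𝒟.m + 1 := by
    rw [Module.finrank_eq_card_basis 𝒟.ε, Fintype.card_fin]
  have hoff : gradedOffset k D N = 𝒟.m + 1 := by
    have hbot : (⊥ : Ideal D).restrictScalars k = ⊥ := rfl
    rw [← hdim, ← gradedOffset_add_finrank N, hN, hbot, finrank_bot, add_zero]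
  have hex : ∃ n, (i.succ : ℕ) < gradedOffset k D n := ⟨N, by rw [hoff]; exact i.succ.2⟩
  classical
  -- With `n` minimal, the index lies in the block of degree `n - 1`; the values `n = 0, 1` are
  -- excluded by the offsets `0` and `1`.
  obtain ⟨n, hn, hmin⟩ : ∃ n, (i.succ : ℕ) < gradedOffset k D n ∧
      ∀ l < n, ¬ (i.succ : ℕ) < gradedOffset k D l :=
    ⟨Nat.find hex, Nat.find_spec hex, fun l => Nat.find_min hex⟩
  have h0 : gradedOffset k D 0 = 0 := by simp [gradedOffset]
  have h1 := 𝒟.gradedOffset_one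
  have hs : (i.succ : ℕ) = i + 1 := Fin.val_succ i
  match n, hn, hmin with
  | 0, hn, _ => omega
  | 1, hn, _ => omega
  | n + 2, hn, hmin =>
    obtain ⟨b, hb⟩ := 𝒟.ranked (n + 1)
    obtain ⟨h, -⟩ := hb ⟨i.succ, not_lt.1 (hmin (n + 1) (by omega)), hn⟩
    exact Ideal.pow_le_self (Nat.succ_ne_zero n) h

theorem π_eps (𝒟 : LocalOperatorSystem k D) (i : Fin 𝒟.m) : 𝒟.π (𝒟.eps i) = 0 :=
  (𝒟.ker_π _).2 (𝒟.eps_mem i)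

theorem isNilpotent_eps (𝒟 : LocalOperatorSystem k D) (i : Fin 𝒟.m) : IsNilpotent (𝒟.eps i) := by
  obtain ⟨N, hN⟩ := 𝒟.exists_pow_maximalIdeal_eq_bot
  refine ⟨N, ?_⟩
  have := Ideal.pow_mem_pow (𝒟.eps_mem i) N
  rwa [hN] at this

theorem eq_add_sum_eps (𝒟 : LocalOperatorSystem k D) (x : D) :
    x = 𝒟.ε.repr x 0 • 1 + ∑ i : Fin 𝒟.m, 𝒟.ε.repr x i.succ • 𝒟.eps i := by
  conv_lhs => rw [← 𝒟.ε.sum_repr x, Fin.sum_univ_succ, 𝒟.ε_zero]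
  rfl

theorem repr_zero (𝒟 : LocalOperatorSystem k D) (x : D) : 𝒟.ε.repr x 0 = 𝒟.π x := by
  conv_rhs => rw [𝒟.eq_add_sum_eps x]
  simp [π_eps]

theorem eps_mul_eps (𝒟 : LocalOperatorSystem k D) (p q : Fin 𝒟.m) :
    𝒟.eps p * 𝒟.eps q = ∑ i, 𝒟.α i p q • 𝒟.eps i := by
  conv_lhs => rw [𝒟.eq_add_sum_eps (𝒟.eps p * 𝒟.eps q), repr_zero, map_mul, π_eps, zero_mul,
    zero_smul, zero_add]
  rfl

theorem α_comm (𝒟 : LocalOperatorSystem k D) (i p q : Fin 𝒟.m) : 𝒟.α i p q = 𝒟.α i q p := by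
  rw [α, α, mul_comm]

theorem α_eq_zero_of_mem_null (𝒟 : LocalOperatorSystem k D) (i p : Fin 𝒟.m) {q : Fin 𝒟.m}
    (hq : q ∈ 𝒟.Null) : 𝒟.α i p q = 0 := by
  rw [α_comm, α, hq _ (𝒟.eps_mem p)]; simp

end LocalOperatorSystem

/-! ### Coordinates of `D ⊗ R` with respect to the ranked basis -/

namespace LocalOperatorSystem

variable {k : Type*} [Field k] {D : Type*} [CommRing D] [Algebra k D] [IsLocalRing D]
  (𝒟 : LocalOperatorSystem k D) {R : Type*} [CommRing R] [Algebra k R]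

/-- The coefficient of `ε_p` of an element of `D ⊗ M`. -/
def coef (M : Type*) [AddCommGroup M] [Module k M] (p : Fin (𝒟.m + 1)) : D ⊗[k] M →ₗ[k] M :=
  (TensorProduct.lid k M : k ⊗[k] M →ₗ[k] M) ∘ₗ (𝒟.ε.coord p).rTensor M

/-- The element `1 ⊗ x + ∑ ε_i ⊗ g_i` of `D ⊗ M`. -/
def expand {M : Type*} [AddCommGroup M] [Module k M] (x : M) (g : Fin 𝒟.m → M) : D ⊗[k] M :=
  1 ⊗ₜ x + ∑ i, 𝒟.eps i ⊗ₜ g i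

section Module

variable {M : Type*} [AddCommGroup M] [Module k M]

@[simp] theorem coef_tmul (p : Fin (𝒟.m + 1)) (a : D) (x : M) :
    𝒟.coef M p (a ⊗ₜ x) = 𝒟.ε.repr a p • x := by simp [coef]

@[simp] theorem repr_one (p : Fin (𝒟.m + 1)) :
    𝒟.ε.repr 1 p = if p = 0 then 1 else 0 := by
  rw [← 𝒟.ε_zero, Module.Basis.repr_self, Finsupp.single_apply]; simp [eq_comm]

@[simp] theorem repr_eps (i : Fin 𝒟.m) (p : Fin (𝒟.m + 1)) :
    𝒟.ε.repr (𝒟.eps i) p = if p = i.succ then 1 else 0 := by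
  rw [eps, Module.Basis.repr_self, Finsupp.single_apply]; simp [eq_comm]

@[simp] theorem coef_zero_expand (x : M) (g : Fin 𝒟.m → M) :
    𝒟.coef M 0 (𝒟.expand x g) = x := by
  simp [expand, (Fin.succ_ne_zero _).symm]

@[simp] theorem coef_succ_expand (x : M) (g : Fin 𝒟.m → M) (i : Fin 𝒟.m) :
    𝒟.coef M i.succ (𝒟.expand x g) = g i := by
  simp [expand]

theorem expand_coef (z : D ⊗[k] M) :
    𝒟.expand (𝒟.coef M 0 z) (fun i => 𝒟.coef M i.succ z) = z := by
  induction z with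
  | zero => simp [expand]
  | tmul a x =>
    conv_rhs => rw [𝒟.eq_add_sum_eps a]
    simp only [expand, coef_tmul, TensorProduct.add_tmul, TensorProduct.sum_tmul,
      TensorProduct.smul_tmul]
  | add y z hy hz =>
    conv_rhs => rw [← hy, ← hz]
    simp only [expand, map_add, TensorProduct.tmul_add, Finset.sum_add_distrib]
    abel

theorem expand_inj {x y : M} {g h : Fin 𝒟.m → M} :
    𝒟.expand x g = 𝒟.expand y h ↔ x = y ∧ ∀ i, g i = h i := by
  refine ⟨fun H => ⟨?_, fun i => ?_⟩, fun H => by rw [H.1, funext H.2]⟩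
  · simpa using congrArg (𝒟.coef M 0) H
  · simpa using congrArg (𝒟.coef M i.succ) H

end Module

theorem πBase_expand (x : R) (g : Fin 𝒟.m → R) : 𝒟.πBase R (𝒟.expand x g) = x := by
  simp [πBase, expand, π_eps]

theorem πBase_eq_coef (z : D ⊗[k] R) : 𝒟.πBase R z = 𝒟.coef R 0 z := by
  conv_lhs => rw [← 𝒟.expand_coef z, πBase_expand]

theorem baseMap_expand {S : Type*} [CommRing S] [Algebra k S] (φ : R →ₐ[k] S) (x : R)
    (g : Fin 𝒟.m → R) : baseMap D φ (𝒟.expand x g) = 𝒟.expand (φ x) (fun i => φ (g i)) := by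
  simp [expand]

/-- The structure constants `α` enter here; read on coefficients, this is the twisted Leibniz rule
`del_mul`. -/
theorem expand_mul (x y : R) (g h : Fin 𝒟.m → R) :
    𝒟.expand x g * 𝒟.expand y h = 𝒟.expand (x * y)
      (fun i => x * h i + g i * y + ∑ p, ∑ q, 𝒟.α i p q • (g p * h q)) := by
  have key : ∑ p, ∑ q, (𝒟.eps p * 𝒟.eps q) ⊗ₜ[k] (g p * h q) =
      ∑ i, 𝒟.eps i ⊗ₜ[k] ∑ p, ∑ q, 𝒟.α i p q • (g p * h q) := by
    simp only [eps_mul_eps, TensorProduct.sum_tmul, TensorProduct.tmul_sum,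
      TensorProduct.smul_tmul]
    exact (Finset.sum_congr rfl fun p _ => Finset.sum_comm).trans Finset.sum_comm
  simp only [expand, add_mul, mul_add, Finset.sum_mul, Finset.mul_sum,
    Algebra.TensorProduct.tmul_mul_tmul, one_mul, mul_one, TensorProduct.tmul_add,
    Finset.sum_add_distrib, key.symm]
  rw [Finset.sum_comm (f := fun q p => (𝒟.eps p * 𝒟.eps q) ⊗ₜ[k] (g p * h q))]
  abel

theorem isNilpotent_eps_tmul (i : Fin 𝒟.m) (x : R) : IsNilpotent (𝒟.eps i ⊗ₜ[k] x) := by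
  obtain ⟨N, hN⟩ := 𝒟.isNilpotent_eps i
  exact ⟨N, by rw [Algebra.TensorProduct.tmul_pow, hN, TensorProduct.zero_tmul]⟩

/-- All `ε_i` with `i ≥ 1` are nilpotent, so `z` differs from its residue by a nilpotent element. -/
theorem isUnit_of_isUnit_πBase {z : D ⊗[k] R} (h : IsUnit (𝒟.πBase R z)) : IsUnit z := by
  rw [← 𝒟.expand_coef z, ← πBase_eq_coef, expand, add_comm]
  refine IsNilpotent.isUnit_add_right_of_commute ?_ ?_ (Commute.all _ _)
  · exact isNilpotent_sum fun i _ => 𝒟.isNilpotent_eps_tmul i _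
  · exact h.map (Algebra.TensorProduct.includeRight : R →ₐ[k] D ⊗[k] R)

end LocalOperatorSystem

/-! ### Operators -/

namespace OperatorStructure

variable {k : Type*} [Field k] {D : Type*} [CommRing D] [Algebra k D] [IsLocalRing D]
  {𝒟 : LocalOperatorSystem k D} {R : Type*} [CommRing R] [Algebra k R]
  {S : Type*} [CommRing S] [Algebra k S]

theorem del_eq_coef (E : OperatorStructure 𝒟 R) (i : Fin 𝒟.m) (x : R) :
    E.del i x = 𝒟.coef R i.succ (E.e x) := rfl

theorem e_eq (E : OperatorStructure 𝒟 R) (x : R) :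
    E.e x = 𝒟.expand x (fun i => E.del i x) := by
  have h : 𝒟.coef R 0 (E.e x) = x := by
    rw [← 𝒟.πBase_eq_coef]; exact DFunLike.congr_fun E.residue_comp x
  conv_lhs => rw [← 𝒟.expand_coef (E.e x), h]
  rfl

/-- The operators as `k`-linear maps. -/
def delₗ (E : OperatorStructure 𝒟 R) (i : Fin 𝒟.m) : R →ₗ[k] R :=
  𝒟.coef R i.succ ∘ₗ E.e.toLinearMap

theorem del_add (E : OperatorStructure 𝒟 R) (i : Fin 𝒟.m) (x y : R) :
    E.del i (x + y) = E.del i x + E.del i y := (E.delₗ i).map_add x y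

theorem del_sum (E : OperatorStructure 𝒟 R) (i : Fin 𝒟.m) {ι : Type*} (s : Finset ι)
    (f : ι → R) : E.del i (∑ a ∈ s, f a) = ∑ a ∈ s, E.del i (f a) := map_sum (E.delₗ i) f s

theorem del_mul (E : OperatorStructure 𝒟 R) (i : Fin 𝒟.m) (x y : R) :
    E.del i (x * y) = x * E.del i y + E.del i x * y +
      ∑ p, ∑ q, 𝒟.α i p q • (E.del p x * E.del q y) := by
  rw [del_eq_coef, map_mul, e_eq, e_eq, 𝒟.expand_mul, 𝒟.coef_succ_expand]

theorem baseMap_e_eq_iff (E : OperatorStructure 𝒟 R) (E' : OperatorStructure 𝒟 S) (φ : R →ₐ[k] S)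
    (x : R) : baseMap D φ (E.e x) = E'.e (φ x) ↔ ∀ i, φ (E.del i x) = E'.del i (φ x) := by
  rw [e_eq, e_eq, 𝒟.baseMap_expand, 𝒟.expand_inj]
  simp

theorem baseMap_comp_e_iff (E : OperatorStructure 𝒟 R) (E' : OperatorStructure 𝒟 S)
    (φ : R →ₐ[k] S) : (baseMap D φ).comp E.e = E'.e.comp φ ↔
      ∀ i x, φ (E.del i x) = E'.del i (φ x) := by
  rw [DFunLike.ext_iff, forall_comm]
  exact forall_congr' fun x => E.baseMap_e_eq_iff E' φ x

/-- The operator structure with underlying homomorphism `f`. -/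
def ofAlgHom (f : R →ₐ[k] D ⊗[k] R) (hf : ∀ x, 𝒟.πBase R (f x) = x) :
    OperatorStructure 𝒟 R := ⟨f, AlgHom.ext hf⟩

/-- The transport of an operator structure along an isomorphism. -/
def transport (E : OperatorStructure 𝒟 R) (f : R ≃ₐ[k] S) : OperatorStructure 𝒟 S :=
  ofAlgHom (((baseMap D (f : R →ₐ[k] S)).comp E.e).comp (f.symm : S →ₐ[k] R)) fun x => by
    simp only [AlgHom.comp_apply, e_eq, 𝒟.baseMap_expand, 𝒟.πBase_expand]
    exact f.apply_symm_apply x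

theorem transport_del (E : OperatorStructure 𝒟 R) (f : R ≃ₐ[k] S) (i : Fin 𝒟.m) (x : R) :
    (E.transport f).del i (f x) = f (E.del i x) := by
  have h : (E.transport f).e (f x) = baseMap D (f : R →ₐ[k] S) (E.e x) := by
    simp [transport, ofAlgHom]
  exact (((E.baseMap_e_eq_iff (E.transport f) (f : R →ₐ[k] S) x).1 h.symm) i).symm

end OperatorStructure

/-! ### Commutation in terms of the operators -/

section ExpandTwice

variable {k : Type*} [Field k]
  {D₁ : Type*} [CommRing D₁] [Algebra k D₁] [IsLocalRing D₁]
  {D₂ : Type*} [CommRing D₂] [Algebra k D₂] [IsLocalRing D₂]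
  {𝒟₁ : LocalOperatorSystem k D₁} {𝒟₂ : LocalOperatorSystem k D₂}
  {R : Type*} [CommRing R] [Algebra k R]

/-- The element of `D₁ ⊗ (D₂ ⊗ R)` with the given coefficients. -/
def expandTwice (𝒟₁ : LocalOperatorSystem k D₁) (𝒟₂ : LocalOperatorSystem k D₂)
    (x : R) (a : Fin 𝒟₁.m → R) (b : Fin 𝒟₂.m → R) (g : Fin 𝒟₁.m → Fin 𝒟₂.m → R) :
    D₁ ⊗[k] (D₂ ⊗[k] R) :=
  𝒟₁.expand (𝒟₂.expand x b) fun i => 𝒟₂.expand (a i) (g i)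

theorem expandTwice_inj {x : R} {a : Fin 𝒟₁.m → R} {b : Fin 𝒟₂.m → R}
    {g h : Fin 𝒟₁.m → Fin 𝒟₂.m → R} :
    expandTwice 𝒟₁ 𝒟₂ x a b g = expandTwice 𝒟₁ 𝒟₂ x a b h ↔ ∀ i j, g i j = h i j := by
  simp only [expandTwice, 𝒟₁.expand_inj, 𝒟₂.expand_inj, true_and]

theorem expandTwice_eq (x : R) (a : Fin 𝒟₁.m → R) (b : Fin 𝒟₂.m → R)
    (g : Fin 𝒟₁.m → Fin 𝒟₂.m → R) :
    expandTwice 𝒟₁ 𝒟₂ x a b g = 1 ⊗ₜ (1 ⊗ₜ x) + ∑ j, 1 ⊗ₜ (𝒟₂.eps j ⊗ₜ b j) +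
      ∑ i, 𝒟₁.eps i ⊗ₜ (1 ⊗ₜ a i) + ∑ i, ∑ j, 𝒟₁.eps i ⊗ₜ (𝒟₂.eps j ⊗ₜ g i j) := by
  simp only [expandTwice, LocalOperatorSystem.expand, TensorProduct.tmul_add,
    TensorProduct.tmul_sum, Finset.sum_add_distrib]
  abel

theorem baseMap_e_e (E₁ : OperatorStructure 𝒟₁ R) (E₂ : OperatorStructure 𝒟₂ R) (x : R) :
    baseMap D₁ E₂.e (E₁.e x) = expandTwice 𝒟₁ 𝒟₂ x (fun i => E₁.del i x) (fun j => E₂.del j x)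
      fun i j => E₂.del j (E₁.del i x) := by
  rw [E₁.e_eq, 𝒟₁.baseMap_expand, expandTwice]
  simp only [E₂.e_eq]

end ExpandTwice

theorem baseMap_includeRight_e {k : Type*} [Field k]
    {D₁ : Type*} [CommRing D₁] [Algebra k D₁] [IsLocalRing D₁]
    {D₂ : Type*} [CommRing D₂] [Algebra k D₂] {𝒟₁ : LocalOperatorSystem k D₁}
    {R : Type*} [CommRing R] [Algebra k R] (E₁ : OperatorStructure 𝒟₁ R) (x : R) :
    ((baseMap D₁ (Algebra.TensorProduct.includeRight : R →ₐ[k] D₂ ⊗[k] R)).comp E₁.e) x =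
      1 ⊗ₜ (1 ⊗ₜ x) + ∑ i, 𝒟₁.eps i ⊗ₜ (1 ⊗ₜ E₁.del i x) := by
  rw [AlgHom.comp_apply, E₁.e_eq, 𝒟₁.baseMap_expand]
  rfl

theorem liftAlong_e {k : Type*} [Field k]
    {D₁ : Type*} [CommRing D₁] [Algebra k D₁]
    {D₂ : Type*} [CommRing D₂] [Algebra k D₂] [IsLocalRing D₂]
    {𝒟₂ : LocalOperatorSystem k D₂} {F : Type*} [Field F] [Algebra k F]
    {R : Type*} [CommRing R] [Algebra k R] [Algebra F R] [IsScalarTower k F R]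
    (r : D₂ →ₐ[k] D₁ ⊗[k] (D₂ ⊗[k] F)) (g : R →ₐ[k] D₁ ⊗[k] (D₂ ⊗[k] R))
    (E₂ : OperatorStructure 𝒟₂ R) (x : R) :
    liftAlong r g (E₂.e x) = g x + ∑ ℓ,
      baseMap D₁ (baseMap D₂ (IsScalarTower.toAlgHom k F R)) (r (𝒟₂.eps ℓ)) *
        g (E₂.del ℓ x) := by
  rw [E₂.e_eq]
  simp [liftAlong, LocalOperatorSystem.expand]

section Commutation

variable {k : Type*} [Field k]
  {D₁ : Type*} [CommRing D₁] [Algebra k D₁] [IsLocalRing D₁]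
  {D₂ : Type*} [CommRing D₂] [Algebra k D₂] [IsLocalRing D₂]
  {𝒟₁ : LocalOperatorSystem k D₁} {𝒟₂ : LocalOperatorSystem k D₂}
  {F : Type*} [Field F] [Algebra k F]
  {R : Type*} [CommRing R] [Algebra k R] [Algebra F R] [IsScalarTower k F R]

theorem liftTwisted_canonical_e (E₁ : OperatorStructure 𝒟₁ R) (E₂ : OperatorStructure 𝒟₂ R)
    (x : R) : liftTwisted (canonicalEmbedding k D₁ D₂ F) E₁.e (E₂.e x) =
      expandTwice 𝒟₁ 𝒟₂ x (fun i => E₁.del i x) (fun j => E₂.del j x)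
        fun i j => E₁.del i (E₂.del j x) := by
  rw [liftTwisted, liftAlong_e, expandTwice_eq]
  simp only [baseMap_includeRight_e]
  simp only [canonicalEmbedding, AlgHom.comp_apply, Algebra.TensorProduct.includeLeft_apply,
    Algebra.TensorProduct.includeRight_apply, Algebra.TensorProduct.map_tmul, map_one, mul_add,
    Algebra.TensorProduct.tmul_mul_tmul, one_mul, mul_one, Finset.mul_sum,
    Finset.sum_add_distrib, AlgHom.coe_id, id_eq]
  rw [Finset.sum_comm (f := fun j i => 𝒟₁.eps i ⊗ₜ[k] (𝒟₂.eps j ⊗ₜ[k] E₁.del i (E₂.del j x)))]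
  abel

theorem sum_tmul_tmul_sum {n : ℕ} (f : Fin n → Fin 𝒟₁.m → Fin 𝒟₂.m → R) :
    ∑ i, ∑ j, 𝒟₁.eps i ⊗ₜ[k] (𝒟₂.eps j ⊗ₜ[k] ∑ ℓ, f ℓ i j) =
      ∑ ℓ, ∑ i, ∑ j, 𝒟₁.eps i ⊗ₜ[k] (𝒟₂.eps j ⊗ₜ[k] f ℓ i j) := by
  simp only [TensorProduct.tmul_sum]
  exact (Finset.sum_congr rfl fun i _ => Finset.sum_comm).trans Finset.sum_comm

theorem liftStandard_e {r : D₂ →ₐ[k] D₂ ⊗[k] (D₂ ⊗[k] F)}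
    {c : Fin 𝒟₂.m → Fin 𝒟₂.m → Fin 𝒟₂.m → F} (hr : IsHSType 𝒟₂ r c)
    (E₂ : OperatorStructure 𝒟₂ R) (x : R) : liftStandard r (E₂.e x) =
      expandTwice 𝒟₂ 𝒟₂ x (fun i => E₂.del i x) (fun j => E₂.del j x)
        fun i j => ∑ ℓ, c ℓ j i • E₂.del ℓ x := by
  rw [liftStandard, liftAlong_e, expandTwice_eq, sum_tmul_tmul_sum]
  simp only [hr _, map_add, map_sum, AlgHom.comp_apply, Algebra.TensorProduct.includeRight_apply,
    Algebra.TensorProduct.map_tmul, map_one, add_mul, Finset.sum_mul,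
    Algebra.TensorProduct.tmul_mul_tmul, one_mul, mul_one, Finset.sum_add_distrib,
    IsScalarTower.coe_toAlgHom', AlgHom.coe_id, id_eq, Algebra.smul_def]
  abel

theorem liftTwisted_lie_e {r : D₁ →ₐ[k] D₁ ⊗[k] (D₁ ⊗[k] F)}
    {c : Fin 𝒟₁.m → Fin 𝒟₁.m → Fin 𝒟₁.m → F} (hr : IsLieType 𝒟₁ r c)
    (E₁ : OperatorStructure 𝒟₁ R) (x : R) : liftTwisted r E₁.e (E₁.e x) =
      expandTwice 𝒟₁ 𝒟₁ x (fun i => E₁.del i x) (fun j => E₁.del j x)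
        fun i j => E₁.del i (E₁.del j x) + ∑ ℓ, c ℓ j i • E₁.del ℓ x := by
  -- The twist by `e₁` multiplies each coefficient term `ε_i ⊗ ε_j ⊗ c` by further `ε_p ⊗ 1`. Where
  -- `c ≠ 0`, `ε_i` annihilates `𝔪`, so only the untwisted part survives.
  have hz : ∀ ℓ i j p, ∀ y : R,
      (𝒟₁.eps i * 𝒟₁.eps p) ⊗ₜ[k] (𝒟₁.eps j ⊗ₜ[k] (algebraMap F R (c ℓ j i) * y)) = 0 := by
    intro ℓ i j p y
    by_cases h : i ∈ 𝒟₁.Null ∧ j ∈ 𝒟₁.Null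
    · rw [h.1 _ (𝒟₁.eps_mem p), TensorProduct.zero_tmul]
    · rw [hr.2 ℓ i j h]; simp
  rw [liftTwisted, liftAlong_e, expandTwice_eq]
  simp only [TensorProduct.tmul_add, Finset.sum_add_distrib, sum_tmul_tmul_sum]
  simp only [baseMap_includeRight_e]
  simp only [hr.1 _, map_add, map_sum, mul_add, Finset.mul_sum,
    Algebra.TensorProduct.map_tmul, map_one, add_mul, Finset.sum_mul,
    Algebra.TensorProduct.tmul_mul_tmul, one_mul, mul_one, Finset.sum_add_distrib,
    IsScalarTower.coe_toAlgHom', AlgHom.coe_id, id_eq, Algebra.smul_def, hz,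
    Finset.sum_const_zero, add_zero]
  rw [Finset.sum_comm (f := fun j i => 𝒟₁.eps i ⊗ₜ[k] (𝒟₁.eps j ⊗ₜ[k] E₁.del i (E₁.del j x)))]
  abel

/-- Both sides agree in all coefficients involving a factor `1`, so only those at `ε_i ⊗ ε_j`
matter. There the left side has `∂_j ∂_i x`, which accounts for the exchange of indices. -/
theorem lie_commute_iff {r : D₁ →ₐ[k] D₁ ⊗[k] (D₁ ⊗[k] F)}
    {c : Fin 𝒟₁.m → Fin 𝒟₁.m → Fin 𝒟₁.m → F} (hr : IsLieType 𝒟₁ r c)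
    (E₁ : OperatorStructure 𝒟₁ R) (x : R) :
    baseMap D₁ E₁.e (E₁.e x) = liftTwisted r E₁.e (E₁.e x) ↔
      ∀ i j, E₁.del i (E₁.del j x) = E₁.del j (E₁.del i x) + ∑ ℓ, c ℓ i j • E₁.del ℓ x := by
  rw [baseMap_e_e, liftTwisted_lie_e hr, expandTwice_inj, forall_comm]

theorem hs_commute_iff {r : D₂ →ₐ[k] D₂ ⊗[k] (D₂ ⊗[k] F)}
    {c : Fin 𝒟₂.m → Fin 𝒟₂.m → Fin 𝒟₂.m → F} (hr : IsHSType 𝒟₂ r c)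
    (E₂ : OperatorStructure 𝒟₂ R) (x : R) :
    baseMap D₂ E₂.e (E₂.e x) = liftStandard r (E₂.e x) ↔
      ∀ i j, E₂.del i (E₂.del j x) = ∑ ℓ, c ℓ i j • E₂.del ℓ x := by
  rw [baseMap_e_e, liftStandard_e hr, expandTwice_inj, forall_comm]

variable (F) in
theorem mixed_commute_iff (E₁ : OperatorStructure 𝒟₁ R) (E₂ : OperatorStructure 𝒟₂ R) (x : R) :
    baseMap D₁ E₂.e (E₁.e x) = liftTwisted (canonicalEmbedding k D₁ D₂ F) E₁.e (E₂.e x) ↔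
      ∀ i j, E₂.del j (E₁.del i x) = E₁.del i (E₂.del j x) := by
  rw [baseMap_e_e, liftTwisted_canonical_e, expandTwice_inj]

end Commutation

section Pair

variable {k : Type*} [Field k]
  {D₁ : Type*} [CommRing D₁] [Algebra k D₁] [IsLocalRing D₁]
  {D₂ : Type*} [CommRing D₂] [Algebra k D₂] [IsLocalRing D₂]
  {𝒟₁ : LocalOperatorSystem k D₁} {𝒟₂ : LocalOperatorSystem k D₂}
  {F : Type*} [Field F] [Algebra k F]
  {R : Type*} [CommRing R] [Algebra k R]

/-- The commutation relations of `Γ` hold at `x`. -/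
structure LHSSystem.CommutesAt [Algebra F R] (Γ : LHSSystem 𝒟₁ 𝒟₂ F)
    (E : PairStructure 𝒟₁ 𝒟₂ R) (x : R) : Prop where
  lie : ∀ i j, E.fst.del i (E.fst.del j x) =
    E.fst.del j (E.fst.del i x) + ∑ ℓ, Γ.c₁ ℓ i j • E.fst.del ℓ x
  hs : ∀ i j, E.snd.del i (E.snd.del j x) = ∑ ℓ, Γ.c₂ ℓ i j • E.snd.del ℓ x
  mixed : ∀ i j, E.snd.del j (E.fst.del i x) = E.fst.del i (E.snd.del j x)

theorem LHSSystem.commutes_iff [Algebra F R] [IsScalarTower k F R] (Γ : LHSSystem 𝒟₁ 𝒟₂ F)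
    (E : PairStructure 𝒟₁ 𝒟₂ R) : Γ.Commutes E ↔ ∀ x, Γ.CommutesAt E x := by
  simp only [Commutes, CommuteWrt, DFunLike.ext_iff, AlgHom.comp_apply]
  simp only [lie_commute_iff Γ.lie, hs_commute_iff Γ.hs, mixed_commute_iff F]
  exact ⟨fun h x => ⟨h.1 x, h.2.1 x, h.2.2 x⟩,
    fun h => ⟨fun x => (h x).lie, fun x => (h x).hs, fun x => (h x).mixed⟩⟩

namespace PairStructure

variable {S : Type*} [CommRing S] [Algebra k S]

theorem isHom_iff (E : PairStructure 𝒟₁ 𝒟₂ R) (E' : PairStructure 𝒟₁ 𝒟₂ S) (φ : R →ₐ[k] S) :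
    E.IsHom E' φ ↔ (∀ i x, φ (E.fst.del i x) = E'.fst.del i (φ x)) ∧
      ∀ i x, φ (E.snd.del i x) = E'.snd.del i (φ x) := by
  rw [IsHom, E.fst.baseMap_comp_e_iff, E.snd.baseMap_comp_e_iff]

theorem IsHom.op {E : PairStructure 𝒟₁ 𝒟₂ R} {E' : PairStructure 𝒟₁ 𝒟₂ S} {φ : R →ₐ[k] S}
    (h : E.IsHom E' φ) (i : OpIndex 𝒟₁ 𝒟₂) (x : R) : φ (E.op i x) = E'.op i (φ x) := by
  rw [isHom_iff] at h
  unfold PairStructure.op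
  rcases ofLex i with j | j
  · exact h.2 j x
  · exact h.1 j x

theorem isHom_iff_op (E : PairStructure 𝒟₁ 𝒟₂ R) (E' : PairStructure 𝒟₁ 𝒟₂ S) (φ : R →ₐ[k] S) :
    E.IsHom E' φ ↔ ∀ i x, φ (E.op i x) = E'.op i (φ x) := by
  refine ⟨fun h => h.op, fun h => (E.isHom_iff E' φ).2 ⟨fun i x => ?_, fun i x => ?_⟩⟩
  · exact h (toLex (Sum.inr i)) x
  · exact h (toLex (Sum.inl i)) x

theorem IsHom.iter {E : PairStructure 𝒟₁ 𝒟₂ R} {E' : PairStructure 𝒟₁ 𝒟₂ S} {φ : R →ₐ[k] S}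
    (h : E.IsHom E' φ) (ξ : List (OpIndex 𝒟₁ 𝒟₂)) (x : R) :
    φ (E.iter ξ x) = E'.iter ξ (φ x) := by
  induction ξ with
  | nil => rfl
  | cons i ξ ih => exact (h.op i _).trans (congrArg _ ih)

theorem IsHom.comp {E : PairStructure 𝒟₁ 𝒟₂ R} {E' : PairStructure 𝒟₁ 𝒟₂ S}
    {T : Type*} [CommRing T] [Algebra k T] {E'' : PairStructure 𝒟₁ 𝒟₂ T} {φ : R →ₐ[k] S}
    {ψ : S →ₐ[k] T} (hψ : E'.IsHom E'' ψ) (hφ : E.IsHom E' φ) : E.IsHom E'' (ψ.comp φ) := by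
  rw [isHom_iff_op]
  intro i x
  rw [AlgHom.comp_apply, hφ.op, hψ.op]; rfl

/-- The transport of a pair of operator structures along an isomorphism. -/
def transport (E : PairStructure 𝒟₁ 𝒟₂ R) (f : R ≃ₐ[k] S) : PairStructure 𝒟₁ 𝒟₂ S :=
  ⟨E.fst.transport f, E.snd.transport f⟩

theorem isHom_transport (E : PairStructure 𝒟₁ 𝒟₂ R) (f : R ≃ₐ[k] S) :
    E.IsHom (E.transport f) (f : R →ₐ[k] S) :=
  (isHom_iff _ _ _).2 ⟨fun i x => (E.fst.transport_del f i x).symm,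
    fun i x => (E.snd.transport_del f i x).symm⟩

theorem IsHom.symm {E : PairStructure 𝒟₁ 𝒟₂ R} {E' : PairStructure 𝒟₁ 𝒟₂ S} {f : R ≃ₐ[k] S}
    (h : E.IsHom E' (f : R →ₐ[k] S)) : E'.IsHom E (f.symm : S →ₐ[k] R) := by
  rw [isHom_iff_op] at h ⊢
  intro i x
  obtain ⟨y, rfl⟩ := f.surjective x
  have h1 : f (E.op i y) = E'.op i (f y) := h i y
  change f.symm (E'.op i (f y)) = E.op i (f.symm (f y))
  rw [← h1, f.symm_apply_apply, f.symm_apply_apply]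

end PairStructure

/-- Commutation relations are preserved by homomorphisms. -/
theorem LHSSystem.CommutesAt.map {S : Type*} [CommRing S] [Algebra k S] [Algebra F R]
    [Algebra F S] {Γ : LHSSystem 𝒟₁ 𝒟₂ F} {E : PairStructure 𝒟₁ 𝒟₂ R}
    {E' : PairStructure 𝒟₁ 𝒟₂ S} {φ : R →ₐ[k] S} (h : E.IsHom E' φ)
    (hF : ∀ f : F, ∀ x, φ (f • x) = f • φ x) {x : R}
    (hx : Γ.CommutesAt E x) : Γ.CommutesAt E' (φ x) := by
  rw [PairStructure.isHom_iff] at h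
  refine ⟨fun i j => ?_, fun i j => ?_, fun i j => ?_⟩
  · simp only [← h.1, hx.lie i j, map_add, map_sum, hF]
  · simp only [← h.2, hx.hs i j, map_sum, hF]
  · simp only [← h.1, ← h.2, hx.mixed i j]

end Pair

/-! ### Subalgebras on which relations hold -/

section Subalgebras

variable {k : Type*} [Field k]
  {D₁ : Type*} [CommRing D₁] [Algebra k D₁] [IsLocalRing D₁]
  {D₂ : Type*} [CommRing D₂] [Algebra k D₂] [IsLocalRing D₂]
  {𝒟₁ : LocalOperatorSystem k D₁} {𝒟₂ : LocalOperatorSystem k D₂}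
  {F : Type*} [Field F] [Algebra k F]
  {R : Type*} [CommRing R] [Algebra k R]

/-- The subalgebra on which `φ` commutes with the operators. -/
def homSubalgebra {S : Type*} [CommRing S] [Algebra k S] (E : OperatorStructure 𝒟₁ R)
    (E' : OperatorStructure 𝒟₁ S) (φ : R →ₐ[k] S) : Subalgebra k R :=
  AlgHom.equalizer ((baseMap D₁ φ).comp E.e) (E'.e.comp φ)

theorem mem_homSubalgebra {S : Type*} [CommRing S] [Algebra k S] {E : OperatorStructure 𝒟₁ R}
    {E' : OperatorStructure 𝒟₁ S} {φ : R →ₐ[k] S} {x : R} :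
    x ∈ homSubalgebra E E' φ ↔ ∀ i, φ (E.del i x) = E'.del i (φ x) :=
  E.baseMap_e_eq_iff E' φ x

variable [Algebra F R] [IsScalarTower k F R]

/-- The subalgebra on which `Γ`-commutation holds. -/
def LHSSystem.commSubalgebra (Γ : LHSSystem 𝒟₁ 𝒟₂ F) (E : PairStructure 𝒟₁ 𝒟₂ R) :
    Subalgebra k R :=
  AlgHom.equalizer ((baseMap D₁ E.fst.e).comp E.fst.e)
      ((liftTwisted Γ.r₁ E.fst.e).comp E.fst.e) ⊓
    (AlgHom.equalizer ((baseMap D₂ E.snd.e).comp E.snd.e)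
      ((liftStandard Γ.r₂).comp E.snd.e) ⊓
    AlgHom.equalizer ((baseMap D₁ E.snd.e).comp E.fst.e)
      ((liftTwisted (canonicalEmbedding k D₁ D₂ F) E.fst.e).comp E.snd.e))

theorem LHSSystem.mem_commSubalgebra {Γ : LHSSystem 𝒟₁ 𝒟₂ F} {E : PairStructure 𝒟₁ 𝒟₂ R}
    {x : R} : x ∈ Γ.commSubalgebra E ↔ Γ.CommutesAt E x := by
  simp only [commSubalgebra, Algebra.mem_inf, AlgHom.mem_equalizer, AlgHom.comp_apply]
  simp only [lie_commute_iff Γ.lie, hs_commute_iff Γ.hs, mixed_commute_iff F]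
  exact ⟨fun h => ⟨h.1, h.2.1, h.2.2⟩, fun h => ⟨h.lie, h.hs, h.mixed⟩⟩

end Subalgebras

/-! ### Operators on scalars -/

section Extends

variable {k : Type*} [Field k] {D : Type*} [CommRing D] [Algebra k D] [IsLocalRing D]
  {𝒟 : LocalOperatorSystem k D} {F : Type*} [Field F] [Algebra k F]
  {R : Type*} [CommRing R] [Algebra k R] [Algebra F R]

/-- The structure map `F → R` commutes with the operators. -/
def OperatorStructure.Extends (E : OperatorStructure 𝒟 R) (EF : OperatorStructure 𝒟 F) : Prop :=
  ∀ i f, E.del i (algebraMap F R f) = algebraMap F R (EF.del i f)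

variable {E : OperatorStructure 𝒟 R} {EF : OperatorStructure 𝒟 F}

theorem OperatorStructure.Extends.del_smul [IsScalarTower k F R] (h : E.Extends EF)
    (i : Fin 𝒟.m) (f : F) (x : R) :
    E.del i (f • x) = f • E.del i x + EF.del i f • x +
      ∑ p, ∑ q, 𝒟.α i p q • (EF.del p f • E.del q x) := by
  simp only [Algebra.smul_def f, E.del_mul, h _ _]
  simp only [Algebra.smul_def (R := F)]

theorem OperatorStructure.Extends.del_smul_const [IsScalarTower k F R] (h : E.Extends EF)
    (i : Fin 𝒟.m) {f : F} (hf : ∀ j, EF.del j f = 0) (x : R) :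
    E.del i (f • x) = f • E.del i x := by
  rw [h.del_smul]; simp [hf]

theorem OperatorStructure.Extends.trans {K : Type*} [Field K] [Algebra k K] [Algebra F K]
    [Algebra K R] [IsScalarTower F K R] {EK : OperatorStructure 𝒟 K}
    (h : E.Extends EK) (hK : EK.Extends EF) : E.Extends EF := by
  intro i f
  rw [IsScalarTower.algebraMap_apply F K R, h, hK, ← IsScalarTower.algebraMap_apply]

end Extends

/-! ### The Jacobi identity -/

/-- The relation of Lie type for a fixed pair of indices is additive. -/
theorem lie_relation_add {k : Type*} [Field k] {D : Type*} [CommRing D] [Algebra k D]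
    [IsLocalRing D] {𝒟 : LocalOperatorSystem k D} {F : Type*} [Field F]
    {R : Type*} [CommRing R] [Algebra k R] [Algebra F R]
    {E : OperatorStructure 𝒟 R} {c : Fin 𝒟.m → Fin 𝒟.m → Fin 𝒟.m → F} {x y : R}
    {i j : Fin 𝒟.m}
    (hx : E.del i (E.del j x) = E.del j (E.del i x) + ∑ ℓ, c ℓ i j • E.del ℓ x)
    (hy : E.del i (E.del j y) = E.del j (E.del i y) + ∑ ℓ, c ℓ i j • E.del ℓ y) :
    E.del i (E.del j (x + y)) = E.del j (E.del i (x + y)) + ∑ ℓ, c ℓ i j • E.del ℓ (x + y) := by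
  simp only [E.del_add, smul_add, Finset.sum_add_distrib, hx, hy]
  abel

/-- The terms at `(q, r)` and `(r, q)` cancel, and symmetry of `y` is needed only where `A` does not
vanish. Pairing terms by an involution instead of halving keeps characteristic two. -/
theorem sum_smul_eq_zero_of_skew {F M : Type*} [CommRing F] [AddCommGroup M] [Module F M] {m : ℕ}
    (A : Fin m → Fin m → F) (y : Fin m → Fin m → M) (hd : ∀ r, A r r = 0)
    (hs : ∀ q r, q < r → A q r + A r q = 0) (hy : ∀ q r, A q r • y q r = A q r • y r q) :
    ∑ q, ∑ r, A q r • y q r = 0 := by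
  rw [← Fintype.sum_prod_type' (f := fun q r => A q r • y q r)]
  have hs' : ∀ q r, A q r + A r q = 0 := by
    intro q r
    rcases lt_trichotomy q r with h | rfl | h
    · exact hs q r h
    · simp [hd]
    · rw [add_comm, hs r q h]
  refine Finset.sum_involution (fun p _ => p.swap) (fun p _ => ?_) (fun p _ hp h => hp ?_)
    (fun p _ => Finset.mem_univ _) (fun p _ => Prod.swap_swap p)
  · change A p.1 p.2 • y p.1 p.2 + A p.2 p.1 • y p.2 p.1 = 0
    rw [hy p.1 p.2, ← add_smul, hs', zero_smul]
  · have : p.2 = p.1 := congrArg Prod.fst h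
    rw [this, hd, zero_smul]

section Jacobi

variable {k : Type*} [Field k] {D : Type*} [CommRing D] [Algebra k D] [IsLocalRing D]
  {𝒟 : LocalOperatorSystem k D} {F : Type*} [Field F] [Algebra k F]
  {R : Type*} [CommRing R] [Algebra k R] [Algebra F R] [IsScalarTower k F R]
  {E : OperatorStructure 𝒟 R} {EF : OperatorStructure 𝒟 F}
  {c : Fin 𝒟.m → Fin 𝒟.m → Fin 𝒟.m → F}

/-- The twisted Leibniz rule expands the left side, and the relation at `v` exchanges `∂_l` with
`∂_ℓ`. This exchange produces the products of two coefficients, the rule itself the derivatives of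
coefficients. -/
theorem del_sum_bracket (hE : E.Extends EF) {v : R}
    (hv : ∀ i j, E.del i (E.del j v) = E.del j (E.del i v) + ∑ ℓ, c ℓ i j • E.del ℓ v)
    (i j l : Fin 𝒟.m) :
    E.del l (∑ ℓ, c ℓ i j • E.del ℓ v) = ∑ ℓ, c ℓ i j • E.del ℓ (E.del l v)
      + ∑ r, (EF.del l (c r i j) - ∑ ℓ, c ℓ i j * c r ℓ l) • E.del r v
      + ∑ q, ∑ r, (∑ p, 𝒟.α l p q • EF.del p (c r i j)) • E.del q (E.del r v) := by
  have h1 : ∑ r, (∑ ℓ, c ℓ i j * c r ℓ l) • E.del r v =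
      ∑ ℓ, c ℓ i j • (E.del ℓ (E.del l v) - E.del l (E.del ℓ v)) := by
    simp only [Finset.sum_smul]
    rw [Finset.sum_comm]
    refine Finset.sum_congr rfl fun ℓ _ => ?_
    rw [hv ℓ l, add_sub_cancel_left, Finset.smul_sum]
    simp only [mul_smul]
  have h2 : ∑ q, ∑ r, (∑ p, 𝒟.α l p q • EF.del p (c r i j)) • E.del q (E.del r v) =
      ∑ ℓ, ∑ p, ∑ q, 𝒟.α l p q • (EF.del p (c ℓ i j) • E.del q (E.del ℓ v)) := by
    rw [Finset.sum_comm]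
    refine Finset.sum_congr rfl fun r _ => ?_
    rw [Finset.sum_comm]
    refine Finset.sum_congr rfl fun q _ => ?_
    rw [Finset.sum_smul]
    exact Finset.sum_congr rfl fun p _ => smul_assoc _ _ _
  simp only [E.del_sum, hE.del_smul, sub_smul, Finset.sum_sub_distrib, Finset.sum_add_distrib,
    h1, h2, smul_sub]
  abel

/-- This is the Jacobi identity for commutators, and it uses the relation at `v` only, not at the
`∂_l v`. Summing `del_sum_bracket` cyclically, the first-order terms vanish by `jacobi` and the
second-order terms by `leibniz_diag` and `leibniz`. -/
theorem IsJacobi.cyclic (hJ : IsJacobi EF c)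
    (hc : ∀ ℓ i j, ¬ (i ∈ 𝒟.Null ∧ j ∈ 𝒟.Null) → c ℓ j i = 0) (hE : E.Extends EF) {v : R}
    (hv : ∀ i j, E.del i (E.del j v) = E.del j (E.del i v) + ∑ ℓ, c ℓ i j • E.del ℓ v)
    (i j l : Fin 𝒟.m) :
    E.del l (∑ ℓ, c ℓ i j • E.del ℓ v) + E.del i (∑ ℓ, c ℓ j l • E.del ℓ v)
        + E.del j (∑ ℓ, c ℓ l i • E.del ℓ v) =
      ∑ ℓ, c ℓ i j • E.del ℓ (E.del l v) + ∑ ℓ, c ℓ j l • E.del ℓ (E.del i v)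
        + ∑ ℓ, c ℓ l i • E.del ℓ (E.del j v) := by
  have h1 : ∑ r, (EF.del l (c r i j) - ∑ ℓ, c ℓ i j * c r ℓ l) • E.del r v +
      ∑ r, (EF.del i (c r j l) - ∑ ℓ, c ℓ j l * c r ℓ i) • E.del r v +
      ∑ r, (EF.del j (c r l i) - ∑ ℓ, c ℓ l i * c r ℓ j) • E.del r v = 0 := by
    rw [← Finset.sum_add_distrib, ← Finset.sum_add_distrib]
    refine Finset.sum_eq_zero fun r _ => ?_
    have := hJ.jacobi i j l r
    simp only [Finset.sum_add_distrib] at this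
    rw [← add_smul, ← add_smul]
    convert zero_smul F (E.del r v)
    linear_combination -this
  have h2 : ∑ q, ∑ r, (∑ p, 𝒟.α l p q • EF.del p (c r i j)) • E.del q (E.del r v) +
      ∑ q, ∑ r, (∑ p, 𝒟.α i p q • EF.del p (c r j l)) • E.del q (E.del r v) +
      ∑ q, ∑ r, (∑ p, 𝒟.α j p q • EF.del p (c r l i)) • E.del q (E.del r v) = 0 := by
    simp only [← Finset.sum_add_distrib, ← add_smul]
    refine sum_smul_eq_zero_of_skew _ _ (fun r => ?_) (fun q r hqr => ?_) (fun q r => ?_)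
    · rw [← hJ.leibniz_diag i j l r]
      exact Finset.sum_congr rfl fun p _ => by abel
    · rw [← hJ.leibniz i j l q r hqr, ← Finset.sum_add_distrib]
      exact Finset.sum_congr rfl fun p _ => by abel
    · rw [hv q r, smul_add, Finset.smul_sum]
      -- Either `ε_q` annihilates `𝔪` and the coefficient is zero, or all `c_ℓ^{qr}` vanish and
      -- `∂_q`, `∂_r` commute at `v`.
      by_cases hq : q ∈ 𝒟.Null
      · simp [𝒟.α_eq_zero_of_mem_null _ _ hq]
      · simp [hc _ r q fun h => hq h.2]
  rw [del_sum_bracket hE hv i j l, del_sum_bracket hE hv j l i, del_sum_bracket hE hv l i j]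
  linear_combination h1 + h2

end Jacobi

/-! ### Operators on polynomial rings -/

section PolyStructure

variable {k : Type*} [Field k] {D : Type*} [CommRing D] [Algebra k D] [IsLocalRing D]
  {𝒟 : LocalOperatorSystem k D} {K : Type*} [Field K] [Algebra k K] {σ : Type*}

/-- The operator structure on a polynomial ring over `K` that extends the one on `K` and has the
given values at the variables. -/
def polyStructure (EK : OperatorStructure 𝒟 K) (g : σ → Fin 𝒟.m → MvPolynomial σ K) :
    OperatorStructure 𝒟 (MvPolynomial σ K) :=
  .ofAlgHom
    { MvPolynomial.eval₂Hom
        ((baseMap D (IsScalarTower.toAlgHom k K (MvPolynomial σ K))).comp EK.e : K →+* _)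
        (fun a => 𝒟.expand (MvPolynomial.X a) (g a)) with
      commutes' := fun r => by
        simp [IsScalarTower.algebraMap_apply k K (MvPolynomial σ K), MvPolynomial.algebraMap_eq] }
    fun x => by
      change ((𝒟.πBase (MvPolynomial σ K) : D ⊗[k] MvPolynomial σ K →+* MvPolynomial σ K).comp
        (MvPolynomial.eval₂Hom _ _)) x = RingHom.id _ x
      congr 1
      refine MvPolynomial.ringHom_ext (fun f => ?_) (fun a => ?_)
      · simp [EK.e_eq, 𝒟.baseMap_expand, 𝒟.πBase_expand, MvPolynomial.algebraMap_eq]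
      · simp [𝒟.πBase_expand]

variable {EK : OperatorStructure 𝒟 K} {g : σ → Fin 𝒟.m → MvPolynomial σ K}

theorem polyStructure_del_X (a : σ) (i : Fin 𝒟.m) :
    (polyStructure EK g).del i (MvPolynomial.X a) = g a i := by
  have h : (polyStructure EK g).e (MvPolynomial.X a) = 𝒟.expand (MvPolynomial.X a) (g a) :=
    MvPolynomial.eval₂Hom_X' _ _ _
  rw [OperatorStructure.del_eq_coef, h, 𝒟.coef_succ_expand]

theorem polyStructure_extends : (polyStructure EK g).Extends EK := by
  intro i f
  have h : (polyStructure EK g).e (MvPolynomial.C f) =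
      baseMap D (IsScalarTower.toAlgHom k K (MvPolynomial σ K)) (EK.e f) :=
    MvPolynomial.eval₂Hom_C _ _ _
  rw [OperatorStructure.del_eq_coef, MvPolynomial.algebraMap_eq, h, EK.e_eq, 𝒟.baseMap_expand,
    𝒟.coef_succ_expand]
  rfl

end PolyStructure

/-- The operators are not `K`-linear, so the loci where relations hold are only `k`-subalgebras; the
scalars from `K` have to be checked separately. -/
theorem Algebra.adjoin_le_of_algebraMap_mem {k K P : Type*} [Field k] [Field K] [CommRing P]
    [Algebra k P] [Algebra K P] {X : Set P} (S : Subalgebra k P)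
    (hK : ∀ f : K, algebraMap K P f ∈ S) (hX : X ⊆ S) {v : P} (hv : v ∈ Algebra.adjoin K X) :
    v ∈ S := by
  induction hv using Algebra.adjoin_induction with
  | mem x hx => exact hX hx
  | algebraMap r => exact hK r
  | add x y _ _ hx hy => exact add_mem hx hy
  | mul x y _ _ hx hy => exact mul_mem hx hy

theorem Multiset.eq_zero_or_exists_max_cons {α : Type*} [LinearOrder α] (s : Multiset α) :
    s = 0 ∨ ∃ (l : α) (t : Multiset α), s = l ::ₘ t ∧ ∀ b ∈ t, b ≤ l := by
  rcases h : s.sort (· ≥ ·) with _ | ⟨l, t⟩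
  · left; rw [← s.sort_eq (· ≥ ·), h]; rfl
  · right
    have hp := s.pairwise_sort (· ≥ ·)
    rw [h, List.pairwise_cons] at hp
    exact ⟨l, t, by rw [← s.sort_eq (· ≥ ·), h]; rfl, fun b hb => hp.1 b (by simpa using hb)⟩

/-! ### Free generation by operators of Lie type -/

section LieStructure

variable {k : Type*} [Field k] {D : Type*} [CommRing D] [Algebra k D] [IsLocalRing D]
  {𝒟 : LocalOperatorSystem k D} {F : Type*} [Field F]
  {K : Type*} [Field K] [Algebra F K] {τ : Type*}

/-- The polynomial ring in the variables `∂_s x_t`. -/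
abbrev LiePoly (𝒟 : LocalOperatorSystem k D) (τ : Type*) (K : Type*) [Field K] : Type _ :=
  MvPolynomial (τ × Multiset (Fin 𝒟.m)) K

/-- The variable `∂_s x_t`. -/
abbrev lieVar {𝒟 : LocalOperatorSystem k D} {K : Type*} [Field K] (t : τ)
    (s : Multiset (Fin 𝒟.m)) : LiePoly 𝒟 τ K :=
  MvPolynomial.X (t, s)

/-- The subalgebra generated by the variables of order at most `n`. -/
def orderLE (𝒟 : LocalOperatorSystem k D) (τ : Type*) (K : Type*) [Field K] (n : ℕ) :
    Subalgebra K (LiePoly 𝒟 τ K) :=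
  Algebra.adjoin K {x | ∃ t s, Multiset.card s ≤ n ∧ x = lieVar t s}

theorem orderLE_mono {m n : ℕ} (h : m ≤ n) : orderLE 𝒟 τ K m ≤ orderLE 𝒟 τ K n :=
  Algebra.adjoin_mono fun _ ⟨t, s, hs, hx⟩ => ⟨t, s, hs.trans h, hx⟩

theorem lieVar_mem {t : τ} {s : Multiset (Fin 𝒟.m)} {n : ℕ} (h : Multiset.card s ≤ n) :
    (lieVar t s : LiePoly 𝒟 τ K) ∈ orderLE 𝒟 τ K n :=
  Algebra.subset_adjoin ⟨t, s, h, rfl⟩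

variable [Algebra k K]

/-- The operator structure with `∂_i (∂_s x_t) = ∂_{is} x_t + ρ i`. -/
def lieStructureOf (EK : OperatorStructure 𝒟 K)
    (ρ : τ → Multiset (Fin 𝒟.m) → Fin 𝒟.m → LiePoly 𝒟 τ K) :
    OperatorStructure 𝒟 (LiePoly 𝒟 τ K) :=
  polyStructure EK fun a i => lieVar a.1 (i ::ₘ a.2) + ρ a.1 a.2 i

theorem lieStructureOf_del_lieVar (EK : OperatorStructure 𝒟 K)
    (ρ : τ → Multiset (Fin 𝒟.m) → Fin 𝒟.m → LiePoly 𝒟 τ K) (t : τ) (s : Multiset (Fin 𝒟.m))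
    (i : Fin 𝒟.m) :
    (lieStructureOf EK ρ).del i (lieVar t s) = lieVar t (i ::ₘ s) + ρ t s i :=
  polyStructure_del_X _ _

/-- Two structures agree on a subalgebra, so corrections at variables of order above `n` are
irrelevant for elements of order at most `n`. -/
theorem lieStructureOf_del_congr {EK : OperatorStructure 𝒟 K}
    {ρ ρ' : τ → Multiset (Fin 𝒟.m) → Fin 𝒟.m → LiePoly 𝒟 τ K} {n : ℕ}
    (h : ∀ t s, Multiset.card s ≤ n → ∀ i, ρ t s i = ρ' t s i) {v : LiePoly 𝒟 τ K}
    (hv : v ∈ orderLE 𝒟 τ K n) (i : Fin 𝒟.m) :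
    (lieStructureOf EK ρ).del i v = (lieStructureOf EK ρ').del i v := by
  refine mem_homSubalgebra.1 (Algebra.adjoin_le_of_algebraMap_mem
    (homSubalgebra (lieStructureOf EK ρ) (lieStructureOf EK ρ') (AlgHom.id k _))
    (fun f => mem_homSubalgebra.2 fun i => ?_) ?_ hv) i
  · exact (polyStructure_extends i f).trans (polyStructure_extends i f).symm
  · rintro _ ⟨t, s, hs, rfl⟩
    refine mem_homSubalgebra.2 fun i => ?_
    simp only [AlgHom.id_apply, lieStructureOf_del_lieVar, h t s hs i]

theorem lieStructureOf_del_mem {EK : OperatorStructure 𝒟 K}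
    {ρ : τ → Multiset (Fin 𝒟.m) → Fin 𝒟.m → LiePoly 𝒟 τ K} {n : ℕ}
    (h : ∀ t s, Multiset.card s ≤ n → ∀ i, ρ t s i ∈ orderLE 𝒟 τ K (Multiset.card s))
    {v : LiePoly 𝒟 τ K} (hv : v ∈ orderLE 𝒟 τ K n) (i : Fin 𝒟.m) :
    (lieStructureOf EK ρ).del i v ∈ orderLE 𝒟 τ K (n + 1) := by
  have hle := orderLE_mono (𝒟 := 𝒟) (τ := τ) (K := K) n.le_succ
  unfold orderLE at hv
  -- All operators are treated at once because the Leibniz rule for one involves the others.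
  induction hv using Algebra.adjoin_induction generalizing i with
  | mem x hx =>
    obtain ⟨t, s, hs, rfl⟩ := hx
    rw [lieStructureOf_del_lieVar]
    exact add_mem (lieVar_mem (by simpa using hs)) (orderLE_mono (by omega) (h t s hs i))
  | algebraMap r =>
    rw [show (lieStructureOf EK ρ).del i (algebraMap K _ r) = _ from polyStructure_extends i r]
    exact Subalgebra.algebraMap_mem _ _
  | add x y _ _ hx hy => rw [OperatorStructure.del_add]; exact add_mem (hx i) (hy i)
  | mul x y hx' hy' hx hy =>
    rw [OperatorStructure.del_mul]
    refine add_mem (add_mem (mul_mem (hle hx') (hy i)) (mul_mem (hx i) (hle hy')))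
      (sum_mem fun p _ => sum_mem fun q _ => ?_)
    rw [← algebraMap_smul K]
    exact Subalgebra.smul_mem _ (mul_mem (hx p) (hy q)) _

/-- The successive approximations to the corrections `∂_i (∂_s x_t) - ∂_{is} x_t`. -/
def lieCorrection (EK : OperatorStructure 𝒟 K) (c : Fin 𝒟.m → Fin 𝒟.m → Fin 𝒟.m → F) :
    ℕ → τ → Multiset (Fin 𝒟.m) → Fin 𝒟.m → LiePoly 𝒟 τ K
  | 0 => fun _ _ _ => 0
  | n + 1 => fun t s i =>
    match s.sort (· ≥ ·) with
    | [] => 0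
    | l :: s' =>
      -- The relation demands `∂_i X_{ls'} = ∂_l ∂_i X_{s'} + ∑ c_ℓ^{il} ∂_ℓ X_{s'}`. Here `∂_i
      -- X_{s'}` is `X_{is'}` plus its correction, and `∂_l X_{is'} = X_{ils'}` because `l` is
      -- maximal. What remains is this expression, computed in the structure of the preceding level.
      if i < l then
        (lieStructureOf EK (lieCorrection EK c n)).del l (lieCorrection EK c n t s' i) +
          ∑ ℓ, c ℓ i l • (lieStructureOf EK (lieCorrection EK c n)).del ℓ (lieVar t s')
      else 0

variable {EK : OperatorStructure 𝒟 K} {c : Fin 𝒟.m → Fin 𝒟.m → Fin 𝒟.m → F}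

theorem lieCorrection_zero (n : ℕ) (t : τ) (i : Fin 𝒟.m) :
    lieCorrection EK c n t 0 i = 0 := by
  cases n <;> simp [lieCorrection]

theorem lieCorrection_cons (n : ℕ) (t : τ) {l : Fin 𝒟.m} {s : Multiset (Fin 𝒟.m)}
    (hl : ∀ b ∈ s, b ≤ l) (i : Fin 𝒟.m) :
    lieCorrection EK c (n + 1) t (l ::ₘ s) i =
      if i < l then
        (lieStructureOf EK (lieCorrection EK c n)).del l (lieCorrection EK c n t s i) +
          ∑ ℓ, c ℓ i l • (lieStructureOf EK (lieCorrection EK c n)).del ℓ (lieVar t s)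
      else 0 := by
  simp only [lieCorrection]
  rw [Multiset.sort_cons l s (· ≥ ·) hl]
  simp only [Multiset.sort_eq]

/-- Level `n` is already final for multisets of size at most `n`. The two claims need a joint
induction: the order bound guarantees that a correction at `ls` differentiates only elements of
order at most `|s|`, where consecutive levels agree. -/
theorem lieCorrection_stable (n : ℕ) (t : τ) {s : Multiset (Fin 𝒟.m)}
    (hs : Multiset.card s ≤ n) (i : Fin 𝒟.m) :
    lieCorrection EK c (n + 1) t s i = lieCorrection EK c n t s i ∧
      lieCorrection EK c n t s i ∈ orderLE 𝒟 τ K (Multiset.card s) := by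
  induction n generalizing t s i with
  | zero =>
    rw [Multiset.card_eq_zero.1 (Nat.le_zero.1 hs), lieCorrection_zero, lieCorrection_zero]
    exact ⟨rfl, zero_mem _⟩
  | succ n ih =>
    rcases s.eq_zero_or_exists_max_cons with rfl | ⟨l, s, rfl, hl⟩
    · rw [lieCorrection_zero, lieCorrection_zero]
      exact ⟨rfl, zero_mem _⟩
    rw [Multiset.card_cons, add_le_add_iff_right] at hs
    rw [lieCorrection_cons _ _ hl, lieCorrection_cons _ _ hl, Multiset.card_cons]
    have hmem : ∀ {v}, v ∈ orderLE 𝒟 τ K (Multiset.card s) → ∀ j,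
        (lieStructureOf EK (lieCorrection EK c n)).del j v ∈
          orderLE 𝒟 τ K (Multiset.card s + 1) := fun hv j =>
      lieStructureOf_del_mem (fun t s' hs' i => (ih t (hs'.trans hs) i).2) hv j
    have hcongr : ∀ {v}, v ∈ orderLE 𝒟 τ K (Multiset.card s) → ∀ j,
        (lieStructureOf EK (lieCorrection EK c (n + 1))).del j v =
          (lieStructureOf EK (lieCorrection EK c n)).del j v := fun hv j =>
      lieStructureOf_del_congr (fun t s' hs' i => (ih t hs' i).1) (orderLE_mono hs hv) j
    have hX : (lieVar t s : LiePoly 𝒟 τ K) ∈ orderLE 𝒟 τ K (Multiset.card s) := lieVar_mem le_rfl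
    rw [(ih t hs i).1]
    simp only [hcongr (ih t hs i).2, hcongr hX, true_and]
    split_ifs
    · refine add_mem (hmem (ih t hs i).2 l) (sum_mem fun ℓ _ => ?_)
      rw [← algebraMap_smul K]
      exact Subalgebra.smul_mem _ (hmem hX ℓ) _
    · exact zero_mem _

theorem lieCorrection_eq {n : ℕ} (t : τ) {s : Multiset (Fin 𝒟.m)}
    (hs : Multiset.card s ≤ n) (i : Fin 𝒟.m) :
    lieCorrection EK c n t s i = lieCorrection EK c (Multiset.card s) t s i := by
  induction n, hs using Nat.le_induction with
  | base => rfl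
  | succ n hn ih => rw [(lieCorrection_stable n t hn i).1, ih]

variable (EK c) in
/-- The operator structure on the polynomial ring that is freely generated under operators of
Lie type. -/
def lieStructure (τ : Type*) : OperatorStructure 𝒟 (LiePoly 𝒟 τ K) :=
  lieStructureOf EK fun t s => lieCorrection EK c (Multiset.card s) t s

theorem lieStructure_extends : (lieStructure EK c τ).Extends EK := polyStructure_extends

theorem lieStructure_del_sub_mem (t : τ) (s : Multiset (Fin 𝒟.m)) (i : Fin 𝒟.m) :
    (lieStructure EK c τ).del i (lieVar t s) - lieVar t (i ::ₘ s) ∈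
      orderLE 𝒟 τ K (Multiset.card s) := by
  rw [lieStructure, lieStructureOf_del_lieVar, add_sub_cancel_left]
  exact (lieCorrection_stable _ t le_rfl i).2

theorem lieStructure_del_max (t : τ) {s : Multiset (Fin 𝒟.m)} {i : Fin 𝒟.m}
    (hi : ∀ b ∈ s, b ≤ i) :
    (lieStructure EK c τ).del i (lieVar t s) = lieVar t (i ::ₘ s) := by
  rw [lieStructure, lieStructureOf_del_lieVar]
  rcases s.eq_zero_or_exists_max_cons with rfl | ⟨l, s, rfl, hl⟩
  · rw [lieCorrection_zero, add_zero]
  · rw [Multiset.card_cons, lieCorrection_cons _ _ hl,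
      if_neg (not_lt.2 (hi l (Multiset.mem_cons_self l s))), add_zero]

/-- The recursion intended for the corrections holds for the final structure itself, since it
coincides with level `|s|` on elements of order at most `|s|`. -/
theorem lieStructure_del_cons (t : τ) {s : Multiset (Fin 𝒟.m)} {i l : Fin 𝒟.m}
    (hl : ∀ b ∈ s, b ≤ l) (hi : i < l) :
    (lieStructure EK c τ).del i (lieVar t (l ::ₘ s)) =
      (lieStructure EK c τ).del l ((lieStructure EK c τ).del i (lieVar t s)) +
        ∑ ℓ, c ℓ i l • (lieStructure EK c τ).del ℓ (lieVar t s) := by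
  have hcongr : ∀ {v}, v ∈ orderLE 𝒟 τ K (Multiset.card s) → ∀ j,
      (lieStructureOf EK (lieCorrection EK c (Multiset.card s))).del j v =
        (lieStructure EK c τ).del j v := fun hv j =>
    lieStructureOf_del_congr (fun t s' hs' i => lieCorrection_eq t hs' i) hv j
  have h1 : (lieStructure EK c τ).del i (lieVar t s) =
      lieVar t (i ::ₘ s) + lieCorrection EK c (Multiset.card s) t s i :=
    lieStructureOf_del_lieVar _ _ _ _ _
  have h2 : ∀ b ∈ i ::ₘ s, b ≤ l := by
    intro b hb
    rcases Multiset.mem_cons.1 hb with rfl | hb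
    · exact hi.le
    · exact hl b hb
  have h3 : (lieStructure EK c τ).del i (lieVar t (l ::ₘ s)) =
      lieVar t (i ::ₘ l ::ₘ s) + lieCorrection EK c (Multiset.card (l ::ₘ s)) t (l ::ₘ s) i :=
    lieStructureOf_del_lieVar _ _ _ _ _
  rw [h3, h1, OperatorStructure.del_add, lieStructure_del_max t h2, Multiset.cons_swap,
    Multiset.card_cons, lieCorrection_cons _ _ hl, if_pos hi]
  simp only [hcongr (lieVar_mem le_rfl), hcongr (lieCorrection_stable _ t le_rfl i).2]
  rw [add_assoc]

end LieStructure

/-! ### The polynomial ring of a commutation system -/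

section PolyPair

variable {k : Type*} [Field k]
  {D₁ : Type*} [CommRing D₁] [Algebra k D₁] [IsLocalRing D₁]
  {D₂ : Type*} [CommRing D₂] [Algebra k D₂] [IsLocalRing D₂]
  {𝒟₁ : LocalOperatorSystem k D₁} {𝒟₂ : LocalOperatorSystem k D₂}
  {F : Type*} [Field F] [Algebra k F] {K : Type*} [Field K] [Algebra k K] [Algebra F K]
  {ι : Type*}

/-- The polynomial ring over `K` in the variables `∂_{1,s} x_t` and `∂_{1,s} ∂_{2,j} x_t`, where `s`
is a multiset. -/
abbrev OpPoly (𝒟₁ : LocalOperatorSystem k D₁) (𝒟₂ : LocalOperatorSystem k D₂) (ι : Type*)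
    (K : Type*) [Field K] : Type _ :=
  LiePoly 𝒟₁ (ι × Option (Fin 𝒟₂.m)) K

/-- The operators of HS-type on the polynomial ring. -/
def hsStructure (EK : OperatorStructure 𝒟₂ K) (c : Fin 𝒟₂.m → Fin 𝒟₂.m → Fin 𝒟₂.m → F)
    (𝒟₁ : LocalOperatorSystem k D₁) (ι : Type*) :
    OperatorStructure 𝒟₂ (OpPoly 𝒟₁ 𝒟₂ ι K) :=
  polyStructure EK fun a j =>
    -- The Lie part `a.2` is untouched, as `∂_{2,j}` is to commute with the Lie operators and `c₂`
    -- is to be constant for them; a second HS operator is absorbed by the iteration rule.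
    match a.1.2 with
    | none => lieVar (a.1.1, some j) a.2
    | some l => ∑ ℓ, c ℓ j l • lieVar (a.1.1, some ℓ) a.2

/-- The `𝒟^Γ`-structure on the polynomial ring. -/
def LHSSystem.polyPair (Γ : LHSSystem 𝒟₁ 𝒟₂ F) (EK : PairStructure 𝒟₁ 𝒟₂ K) (ι : Type*) :
    PairStructure 𝒟₁ 𝒟₂ (OpPoly 𝒟₁ 𝒟₂ ι K) :=
  ⟨lieStructure EK.fst Γ.c₁ _, hsStructure EK.snd Γ.c₂ 𝒟₁ ι⟩

variable {Γ : LHSSystem 𝒟₁ 𝒟₂ F} {EK : PairStructure 𝒟₁ 𝒟₂ K}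

theorem polyPair_fst_extends : (Γ.polyPair EK ι).fst.Extends EK.fst := lieStructure_extends

theorem polyPair_snd_extends : (Γ.polyPair EK ι).snd.Extends EK.snd := polyStructure_extends

theorem polyPair_isAlgebraOver : EK.IsAlgebraOver (Γ.polyPair EK ι) :=
  (PairStructure.isHom_iff _ _ _).2 ⟨fun i f => (polyPair_fst_extends i f).symm,
    fun i f => (polyPair_snd_extends i f).symm⟩

theorem polyPair_snd_del_none (t : ι) (s : Multiset (Fin 𝒟₁.m)) (j : Fin 𝒟₂.m) :
    (Γ.polyPair EK ι).snd.del j (lieVar (t, none) s) = lieVar (t, some j) s :=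
  polyStructure_del_X _ _

theorem polyPair_snd_del_some (t : ι) (s : Multiset (Fin 𝒟₁.m)) (j l : Fin 𝒟₂.m) :
    (Γ.polyPair EK ι).snd.del j (lieVar (t, some l) s) =
      ∑ ℓ, Γ.c₂ ℓ j l • lieVar (t, some ℓ) s :=
  polyStructure_del_X _ _

theorem polyPair_snd_del_mem (a : ι × Option (Fin 𝒟₂.m)) (s : Multiset (Fin 𝒟₁.m))
    (j : Fin 𝒟₂.m) :
    (Γ.polyPair EK ι).snd.del j (lieVar a s) ∈ orderLE 𝒟₁ _ K (Multiset.card s) := by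
  obtain ⟨t, _ | l⟩ := a
  · rw [polyPair_snd_del_none]; exact lieVar_mem le_rfl
  · rw [polyPair_snd_del_some]
    refine sum_mem fun ℓ _ => ?_
    rw [← algebraMap_smul K]
    exact Subalgebra.smul_mem _ (lieVar_mem le_rfl) _

variable {EF : PairStructure 𝒟₁ 𝒟₂ F}

theorem PairStructure.IsAlgebraOver.fst_extends {R : Type*} [CommRing R] [Algebra k R]
    [Algebra F R] [IsScalarTower k F R] {E : PairStructure 𝒟₁ 𝒟₂ R} (h : EF.IsAlgebraOver E) :
    E.fst.Extends EF.fst := fun i f => (((isHom_iff _ _ _).1 h).1 i f).symm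

theorem PairStructure.IsAlgebraOver.snd_extends {R : Type*} [CommRing R] [Algebra k R]
    [Algebra F R] [IsScalarTower k F R] {E : PairStructure 𝒟₁ 𝒟₂ R} (h : EF.IsAlgebraOver E) :
    E.snd.Extends EF.snd := fun i f => (((isHom_iff _ _ _).1 h).2 i f).symm

/-! ### The commutation relations on the polynomial ring -/

section Relations

variable (hΓ : Γ.IsJacobiAssociative EF)

include hΓ in
theorem lie_relation_symm {R : Type*} [CommRing R] [Algebra k R] [Algebra F R]
    {E : OperatorStructure 𝒟₁ R} {x : R} {i j : Fin 𝒟₁.m}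
    (hx : E.del i (E.del j x) = E.del j (E.del i x) + ∑ ℓ, Γ.c₁ ℓ i j • E.del ℓ x) :
    E.del j (E.del i x) = E.del i (E.del j x) + ∑ ℓ, Γ.c₁ ℓ j i • E.del ℓ x := by
  rw [hx, add_assoc, ← Finset.sum_add_distrib]
  simp [hΓ.jacobi.skew _ j i]

include hΓ in
-- For `i < j` this is the defining recursion, for `i = j` it is `c_ℓ^{ii} = 0`. For `i > j`, the
-- index `i` dominates `s` as well, and skew-symmetry reverses the roles.
theorem polyPair_lie_max (a : ι × Option (Fin 𝒟₂.m)) {s : Multiset (Fin 𝒟₁.m)}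
    (i : Fin 𝒟₁.m) {j : Fin 𝒟₁.m} (hj : ∀ b ∈ s, b ≤ j) :
    (Γ.polyPair EK ι).fst.del i ((Γ.polyPair EK ι).fst.del j (lieVar a s)) =
      (Γ.polyPair EK ι).fst.del j ((Γ.polyPair EK ι).fst.del i (lieVar a s)) +
        ∑ ℓ, Γ.c₁ ℓ i j • (Γ.polyPair EK ι).fst.del ℓ (lieVar a s) := by
  have key : ∀ i j : Fin 𝒟₁.m, (∀ b ∈ s, b ≤ j) → i < j →
      (Γ.polyPair EK ι).fst.del i ((Γ.polyPair EK ι).fst.del j (lieVar a s)) =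
        (Γ.polyPair EK ι).fst.del j ((Γ.polyPair EK ι).fst.del i (lieVar a s)) +
          ∑ ℓ, Γ.c₁ ℓ i j • (Γ.polyPair EK ι).fst.del ℓ (lieVar a s) := by
    intro i j hj hij
    simp only [LHSSystem.polyPair]
    rw [lieStructure_del_max a hj, lieStructure_del_cons a hj hij]
  rcases lt_trichotomy i j with h | rfl | h
  · exact key i j hj h
  · simp [hΓ.jacobi.diag]
  · exact lie_relation_symm hΓ (key j i (fun b hb => (hj b hb).trans h.le) h)

variable [IsScalarTower k F K] (hFK : EF.IsAlgebraOver EK)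

include hΓ hFK in
theorem polyPair_mixed_max (a : ι × Option (Fin 𝒟₂.m)) {s : Multiset (Fin 𝒟₁.m)}
    {i : Fin 𝒟₁.m} (hi : ∀ b ∈ s, b ≤ i) (j : Fin 𝒟₂.m) :
    (Γ.polyPair EK ι).snd.del j ((Γ.polyPair EK ι).fst.del i (lieVar a s)) =
      (Γ.polyPair EK ι).fst.del i ((Γ.polyPair EK ι).snd.del j (lieVar a s)) := by
  have hmax : ∀ a, (Γ.polyPair EK ι).fst.del i (lieVar a s) = lieVar a (i ::ₘ s) :=
    fun a => lieStructure_del_max a hi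
  have hext : (Γ.polyPair EK ι).fst.Extends EF.fst :=
    polyPair_fst_extends.trans hFK.fst_extends
  obtain ⟨t, _ | l⟩ := a
  · rw [hmax, polyPair_snd_del_none, polyPair_snd_del_none, hmax]
  · rw [hmax, polyPair_snd_del_some, polyPair_snd_del_some, OperatorStructure.del_sum]
    simp only [hext.del_smul_const _ (fun l => hΓ.fst_const l _ _ _), hmax]

include hΓ hFK in
-- Without an HS index in the variable this is the definition. With an HS index `l`, the twisted
-- Leibniz rule turns `∂_i (∂_j ∂_l) = (∂_i ∂_j) ∂_l` into the associativity equations. The Lie part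
-- plays no role, so no induction is needed.
theorem polyPair_hs (a : ι × Option (Fin 𝒟₂.m)) (s : Multiset (Fin 𝒟₁.m)) (i j : Fin 𝒟₂.m) :
    (Γ.polyPair EK ι).snd.del i ((Γ.polyPair EK ι).snd.del j (lieVar a s)) =
      ∑ ℓ, Γ.c₂ ℓ i j • (Γ.polyPair EK ι).snd.del ℓ (lieVar a s) := by
  have hext : (Γ.polyPair EK ι).snd.Extends EF.snd :=
    polyPair_snd_extends.trans hFK.snd_extends
  obtain ⟨t, _ | l⟩ := a
  · rw [polyPair_snd_del_none, polyPair_snd_del_some]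
    simp only [polyPair_snd_del_none]
  · simp only [polyPair_snd_del_some, OperatorStructure.del_sum, hext.del_smul]
    have h : ∀ r, EF.snd.del i (Γ.c₂ r j l) + ∑ ℓ, (Γ.c₂ ℓ j l * Γ.c₂ r i ℓ
        + ∑ p, ∑ q, 𝒟₂.α i p q • (EF.snd.del p (Γ.c₂ ℓ j l) * Γ.c₂ r q ℓ)) =
          ∑ ℓ, Γ.c₂ ℓ i j * Γ.c₂ r ℓ l := by
      intro r
      rw [← hΓ.assoc i j l r, ← Finset.sum_add_distrib]
      exact Finset.sum_congr rfl fun ℓ _ => by abel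
    have hR : ∑ ℓ, Γ.c₂ ℓ i j • ∑ r, Γ.c₂ r ℓ l • (lieVar (t, some r) s : OpPoly 𝒟₁ 𝒟₂ ι K) =
        ∑ r, (∑ ℓ, Γ.c₂ ℓ i j * Γ.c₂ r ℓ l) • lieVar (t, some r) s := by
      simp only [Finset.smul_sum, Finset.sum_smul, mul_smul]
      exact Finset.sum_comm
    rw [hR]
    simp only [← h, add_smul, Finset.sum_smul, Finset.sum_add_distrib, Finset.smul_sum, mul_smul,
      smul_assoc]
    have h1 : ∑ r, ∑ ℓ, Γ.c₂ ℓ j l • Γ.c₂ r i ℓ •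
        (lieVar (t, some r) s : OpPoly 𝒟₁ 𝒟₂ ι K) =
        ∑ ℓ, ∑ r, Γ.c₂ ℓ j l • Γ.c₂ r i ℓ • lieVar (t, some r) s := Finset.sum_comm
    have h2 : ∑ r, ∑ ℓ, ∑ p, ∑ q, 𝒟₂.α i p q • EF.snd.del p (Γ.c₂ ℓ j l) • Γ.c₂ r q ℓ •
        (lieVar (t, some r) s : OpPoly 𝒟₁ 𝒟₂ ι K) =
        ∑ ℓ, ∑ p, ∑ q, ∑ r, 𝒟₂.α i p q • EF.snd.del p (Γ.c₂ ℓ j l) • Γ.c₂ r q ℓ •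
          lieVar (t, some r) s := by
      rw [Finset.sum_comm]
      refine Finset.sum_congr rfl fun ℓ _ => ?_
      rw [Finset.sum_comm]
      refine Finset.sum_congr rfl fun p _ => ?_
      rw [Finset.sum_comm]
    rw [h1, h2]
    abel

include hΓ hFK in
-- The critical overlap. Writing `X_{ls} = ∂_l X_s` and moving `∂_l` to the front on both sides, the
-- difference left over is exactly the cyclic Jacobi identity at `X_s`.
theorem polyPair_lie_step (a : ι × Option (Fin 𝒟₂.m)) {s : Multiset (Fin 𝒟₁.m)} {l : Fin 𝒟₁.m}
    (hl : ∀ b ∈ s, b ≤ l)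
    (h : ∀ v ∈ orderLE 𝒟₁ _ K (Multiset.card s), Γ.CommutesAt (Γ.polyPair EK ι) v)
    {i j : Fin 𝒟₁.m} (hi : i ≤ l) (hj : j ≤ l) :
    (Γ.polyPair EK ι).fst.del i ((Γ.polyPair EK ι).fst.del j (lieVar a (l ::ₘ s))) =
      (Γ.polyPair EK ι).fst.del j ((Γ.polyPair EK ι).fst.del i (lieVar a (l ::ₘ s))) +
        ∑ ℓ, Γ.c₁ ℓ i j • (Γ.polyPair EK ι).fst.del ℓ (lieVar a (l ::ₘ s)) := by
  set E := (Γ.polyPair EK ι).fst with hE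
  have hext : E.Extends EF.fst := polyPair_fst_extends.trans hFK.fst_extends
  have hv := (h _ (lieVar_mem (t := a) le_rfl)).lie
  rw [← hE] at hv
  have hmax : E.del l (lieVar a s) = lieVar a (l ::ₘ s) := lieStructure_del_max a hl
  -- `∂_j X_s` may have order `|s| + 1`, beyond the reach of `h`. Its leading variable `X_{js}` is
  -- dominated by `l`, and the remainder has order at most `|s|`.
  have hrel : ∀ i j, j ≤ l → E.del i (E.del l (E.del j (lieVar a s))) =
      E.del l (E.del i (E.del j (lieVar a s))) +
        ∑ ℓ, Γ.c₁ ℓ i l • E.del ℓ (E.del j (lieVar a s)) := by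
    intro i j hj
    have hw := lieStructure_del_sub_mem (EK := EK.fst) (c := Γ.c₁) a s j
    change E.del j (lieVar a s) - _ ∈ _ at hw
    rw [← add_sub_cancel (lieVar a (j ::ₘ s)) (E.del j (lieVar a s))]
    refine lie_relation_add (polyPair_lie_max hΓ a i fun b hb => ?_) ((h _ hw).lie i l)
    rcases Multiset.mem_cons.1 hb with rfl | hb
    exacts [hj, hl b hb]
  have hcyc := hΓ.jacobi.cyclic Γ.lie.2 hext hv i j l
  simp only [hΓ.jacobi.skew _ l i, neg_smul, Finset.sum_neg_distrib] at hcyc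
  rw [show E.del j (-∑ ℓ, Γ.c₁ ℓ i l • E.del ℓ (lieVar a s)) =
    -E.del j (∑ ℓ, Γ.c₁ ℓ i l • E.del ℓ (lieVar a s)) from (E.delₗ j).map_neg _] at hcyc
  rw [← hmax, hv j l, hv i l, E.del_add, E.del_add, hrel i j hj, hrel j i hi, hv i j, E.del_add]
  linear_combination hcyc

include hΓ hFK in
-- Again `X_{ls} = ∂_l X_s`. The Lie relation is used at `X_s` and at `∂_{2,j} X_s`, which has no
-- larger order, and `∂_{2,j}` passes the coefficients `c₁` because they are constant for it.
theorem polyPair_mixed_step (a : ι × Option (Fin 𝒟₂.m)) {s : Multiset (Fin 𝒟₁.m)} {l : Fin 𝒟₁.m}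
    (hl : ∀ b ∈ s, b ≤ l)
    (h : ∀ v ∈ orderLE 𝒟₁ _ K (Multiset.card s), Γ.CommutesAt (Γ.polyPair EK ι) v)
    {i : Fin 𝒟₁.m} (hi : i ≤ l) (j : Fin 𝒟₂.m) :
    (Γ.polyPair EK ι).snd.del j ((Γ.polyPair EK ι).fst.del i (lieVar a (l ::ₘ s))) =
      (Γ.polyPair EK ι).fst.del i ((Γ.polyPair EK ι).snd.del j (lieVar a (l ::ₘ s))) := by
  set E := (Γ.polyPair EK ι).fst with hE
  set E' := (Γ.polyPair EK ι).snd with hE'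
  have hext : E'.Extends EF.snd := polyPair_snd_extends.trans hFK.snd_extends
  obtain ⟨hv, -, hm⟩ := h _ (lieVar_mem (t := a) le_rfl)
  have hv' := (h _ (polyPair_snd_del_mem (Γ := Γ) (EK := EK) a s j)).lie
  rw [← hE] at hv hv' hm
  rw [← hE'] at hv' hm
  have hmax : E.del l (lieVar a s) = lieVar a (l ::ₘ s) := lieStructure_del_max a hl
  have hrel : E'.del j (E.del l (E.del i (lieVar a s))) =
      E.del l (E'.del j (E.del i (lieVar a s))) := by
    have hw := lieStructure_del_sub_mem (EK := EK.fst) (c := Γ.c₁) a s i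
    change E.del i (lieVar a s) - _ ∈ _ at hw
    rw [← add_sub_cancel (lieVar a (i ::ₘ s)) (E.del i (lieVar a s))]
    simp only [OperatorStructure.del_add]
    congr 1
    · refine polyPair_mixed_max hΓ hFK a (fun b hb => ?_) j
      rcases Multiset.mem_cons.1 hb with rfl | hb
      exacts [hi, hl b hb]
    · exact (h _ hw).mixed l j
  rw [← hmax, hv i l, hm, hv', E'.del_add, E'.del_sum, hrel, hm]
  simp only [hext.del_smul_const _ (fun l => hΓ.snd_const l _ _ _), hm]

include hΓ hFK in
theorem polyPair_commutesAt (hK : Γ.Commutes EK) (v : OpPoly 𝒟₁ 𝒟₂ ι K) :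
    Γ.CommutesAt (Γ.polyPair EK ι) v := by
  have hbase : ∀ f : K, algebraMap K _ f ∈ Γ.commSubalgebra (Γ.polyPair EK ι) := fun f =>
    LHSSystem.mem_commSubalgebra.2 <| ((Γ.commutes_iff EK).1 hK f).map
      (φ := IsScalarTower.toAlgHom k K _) polyPair_isAlgebraOver fun g x => by
        simp [Algebra.smul_def, IsScalarTower.algebraMap_apply F K (OpPoly 𝒟₁ 𝒟₂ ι K)]
  have hext : ∀ n, (∀ a s, Multiset.card s ≤ n →
      Γ.CommutesAt (Γ.polyPair EK ι) (lieVar a s)) →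
      ∀ v ∈ orderLE 𝒟₁ _ K n, Γ.CommutesAt (Γ.polyPair EK ι) v := fun n hn v hv =>
    LHSSystem.mem_commSubalgebra.1 <| Algebra.adjoin_le_of_algebraMap_mem _ hbase
      (by rintro _ ⟨a, s, hs, rfl⟩; exact LHSSystem.mem_commSubalgebra.2 (hn a s hs)) hv
  have hvar : ∀ n, ∀ a s, Multiset.card s ≤ n →
      Γ.CommutesAt (Γ.polyPair EK ι) (lieVar a s) := by
    intro n
    induction n with
    | zero =>
      intro a s hs
      obtain rfl := Multiset.card_eq_zero.1 (Nat.le_zero.1 hs)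
      exact ⟨fun i j => polyPair_lie_max hΓ a i (by simp), polyPair_hs hΓ hFK a 0,
        fun i j => polyPair_mixed_max hΓ hFK a (by simp) j⟩
    | succ n ih =>
      intro a s hs
      rcases s.eq_zero_or_exists_max_cons with rfl | ⟨l, s, rfl, hl⟩
      · exact ih a 0 (by simp)
      rw [Multiset.card_cons, add_le_add_iff_right] at hs
      have hlow : ∀ v ∈ orderLE 𝒟₁ _ K (Multiset.card s), Γ.CommutesAt (Γ.polyPair EK ι) v :=
        fun v hv => hext n ih v (orderLE_mono hs hv)
      have hmax : ∀ i, l ≤ i → ∀ b ∈ l ::ₘ s, b ≤ i := by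
        intro i hi b hb
        rcases Multiset.mem_cons.1 hb with rfl | hb
        exacts [hi, (hl b hb).trans hi]
      -- As soon as one Lie index in play is at least `l`, it dominates the whole multiset;
      -- otherwise all are at most `l` and the inductive steps apply.
      refine ⟨fun i j => ?_, polyPair_hs hΓ hFK a _, fun i j => ?_⟩
      · rcases le_total l j with hj | hj
        · exact polyPair_lie_max hΓ a i (hmax j hj)
        rcases le_total l i with hi | hi
        · exact lie_relation_symm hΓ (polyPair_lie_max hΓ a j (hmax i hi))
        · exact polyPair_lie_step hΓ hFK a hl hlow hi hj
      · rcases le_total l i with hi | hi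
        · exact polyPair_mixed_max hΓ hFK a (hmax i hi) j
        · exact polyPair_mixed_step hΓ hFK a hl hlow hi j
  refine LHSSystem.mem_commSubalgebra.1 ?_
  have hv : v ∈ Algebra.adjoin K (Set.range MvPolynomial.X) := by
    rw [MvPolynomial.adjoin_range_X]; trivial
  refine Algebra.adjoin_le_of_algebraMap_mem _ hbase ?_ hv
  rintro _ ⟨⟨a, s⟩, rfl⟩
  exact LHSSystem.mem_commSubalgebra.2 (hvar _ a s le_rfl)

end Relations

end PolyPair

/-! ### The universal property -/

section LieIterate

variable {k : Type*} [Field k] {D : Type*} [CommRing D] [Algebra k D] [IsLocalRing D]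
  {𝒟 : LocalOperatorSystem k D} {A : Type*} [CommRing A] [Algebra k A]

/-- The iterate `∂_s` for a multiset `s`. -/
def OperatorStructure.multiIter (E : OperatorStructure 𝒟 A) (s : Multiset (Fin 𝒟.m)) (x : A) : A :=
  (s.sort (· ≥ ·)).foldr E.del x

variable {E : OperatorStructure 𝒟 A}

@[simp] theorem OperatorStructure.multiIter_zero (x : A) : E.multiIter 0 x = x := by
  simp [multiIter]

theorem OperatorStructure.multiIter_cons {s : Multiset (Fin 𝒟.m)} {l : Fin 𝒟.m}
    (hl : ∀ b ∈ s, b ≤ l) (x : A) : E.multiIter (l ::ₘ s) x = E.del l (E.multiIter s x) := by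
  rw [multiIter, Multiset.sort_cons l s (· ≥ ·) hl]; rfl

theorem OperatorStructure.multiIter_comm {φ : A → A} (h : ∀ i x, φ (E.del i x) = E.del i (φ x))
    (s : Multiset (Fin 𝒟.m)) (x : A) : φ (E.multiIter s x) = E.multiIter s (φ x) := by
  unfold multiIter
  induction s.sort (· ≥ ·) with
  | nil => rfl
  | cons i t ih => simp only [List.foldr_cons, h, ih]

theorem OperatorStructure.multiIter_sum (s : Multiset (Fin 𝒟.m)) {ι : Type*} (t : Finset ι)
    (f : ι → A) : E.multiIter s (∑ a ∈ t, f a) = ∑ a ∈ t, E.multiIter s (f a) := by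
  unfold multiIter
  induction s.sort (· ≥ ·) with
  | nil => rfl
  | cons i l ih => simp only [List.foldr_cons, ih, E.del_sum]

end LieIterate

section Universal

variable {k : Type*} [Field k]
  {D₁ : Type*} [CommRing D₁] [Algebra k D₁] [IsLocalRing D₁]
  {D₂ : Type*} [CommRing D₂] [Algebra k D₂] [IsLocalRing D₂]
  {𝒟₁ : LocalOperatorSystem k D₁} {𝒟₂ : LocalOperatorSystem k D₂}
  {F : Type*} [Field F] [Algebra k F] {K : Type*} [Field K] [Algebra k K] [Algebra F K]
  {ι : Type*} {Γ : LHSSystem 𝒟₁ 𝒟₂ F} {EF : PairStructure 𝒟₁ 𝒟₂ F} {EK : PairStructure 𝒟₁ 𝒟₂ K}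
  {A : Type*} [CommRing A] [Algebra k A]

/-- The value of `∂_{1,s} ∂_{2,b} x_t` at `x = a`. -/
def PairStructure.varValue (EA : PairStructure 𝒟₁ 𝒟₂ A) (a : ι → A)
    (p : (ι × Option (Fin 𝒟₂.m)) × Multiset (Fin 𝒟₁.m)) : A :=
  EA.fst.multiIter p.2 (p.1.2.elim (a p.1.1) fun j => EA.snd.del j (a p.1.1))

/-- Uniqueness in the universal property: applying the largest entry last builds each variable from
`x_t` without corrections. -/
theorem polyPair_hom_lieVar {EA : PairStructure 𝒟₁ 𝒟₂ A} {φ : OpPoly 𝒟₁ 𝒟₂ ι K →ₐ[k] A}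
    (hφ : (Γ.polyPair EK ι).IsHom EA φ) (t : ι) (b : Option (Fin 𝒟₂.m))
    (s : Multiset (Fin 𝒟₁.m)) :
    φ (lieVar (t, b) s) = EA.varValue (fun t => φ (lieVar (t, none) 0)) ((t, b), s) := by
  rw [PairStructure.isHom_iff] at hφ
  induction hn : Multiset.card s generalizing s with
  | zero =>
    obtain rfl := Multiset.card_eq_zero.1 hn
    rcases b with _ | j
    · simp [PairStructure.varValue]
    · simp [PairStructure.varValue, ← hφ.2, polyPair_snd_del_none]
  | succ n ih =>
    rcases s.eq_zero_or_exists_max_cons with rfl | ⟨l, s, rfl, hl⟩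
    · simp at hn
    rw [Multiset.card_cons, add_left_inj] at hn
    have h1 : (Γ.polyPair EK ι).fst.del l (lieVar (t, b) s) = lieVar (t, b) (l ::ₘ s) :=
      lieStructure_del_max _ hl
    rw [← h1, hφ.1, ih s hn]
    exact (OperatorStructure.multiIter_cons hl _).symm

/-- The evaluation of operator polynomials at a tuple. -/
def PairStructure.evalAt (EA : PairStructure 𝒟₁ 𝒟₂ A) (a : ι → A) (K : Type*) [Field K]
    [Algebra K A] : OpPoly 𝒟₁ 𝒟₂ ι K →ₐ[K] A :=
  MvPolynomial.aeval (EA.varValue a)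

theorem PairStructure.evalAt_lieVar {K : Type*} [Field K] [Algebra K A] (EA : PairStructure 𝒟₁ 𝒟₂ A) (a : ι → A)
    (t : ι) (b : Option (Fin 𝒟₂.m)) (s : Multiset (Fin 𝒟₁.m)) :
    EA.evalAt a K (lieVar (t, b) s) = EA.varValue a ((t, b), s) :=
  MvPolynomial.aeval_X _ _

variable [Algebra F A] [Algebra K A] [IsScalarTower k K A] [IsScalarTower F K A]
  {EA : PairStructure 𝒟₁ 𝒟₂ A} (hKA : EK.IsAlgebraOver EA)

include hKA in
-- The recursion defining `∂_i` on variables is an instance of the Lie relation, which holds in `A`;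
-- so compatibility propagates by induction on the order.
theorem evalAt_fst (hA : ∀ x, Γ.CommutesAt EA x) (a : ι → A) (v : OpPoly 𝒟₁ 𝒟₂ ι K)
    (i : Fin 𝒟₁.m) : EA.evalAt a K ((Γ.polyPair EK ι).fst.del i v) =
      EA.fst.del i (EA.evalAt a K v) := by
  set E := (Γ.polyPair EK ι).fst with hE
  set ψ := EA.evalAt a K with hψ
  set S := homSubalgebra E EA.fst (ψ.restrictScalars k) with hS
  have mem_S : ∀ v, v ∈ S ↔ ∀ i, ψ (E.del i v) = EA.fst.del i (ψ v) :=
    fun v => mem_homSubalgebra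
  have hbase : ∀ f : K, algebraMap K _ f ∈ S := by
    refine fun f => (mem_S _).2 fun i => ?_
    have h1 : E.del i (algebraMap K _ f) = _ := polyPair_fst_extends i f
    rw [h1, AlgHom.commutes, AlgHom.commutes, hKA.fst_extends]
  have hmax : ∀ t b s i, (∀ b ∈ s, b ≤ i) →
      ψ (E.del i (lieVar (t, b) s)) = EA.fst.del i (ψ (lieVar (t, b) s)) := by
    intro t b s i hi
    rw [show E.del i (lieVar (t, b) s) = lieVar (t, b) (i ::ₘ s) from lieStructure_del_max _ hi,
      hψ, EA.evalAt_lieVar, EA.evalAt_lieVar]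
    exact OperatorStructure.multiIter_cons hi _
  have hext : ∀ n, (∀ t b s, Multiset.card s ≤ n → lieVar (t, b) s ∈ S) →
      ∀ v ∈ orderLE 𝒟₁ _ K n, v ∈ S := fun n hn v hv =>
    Algebra.adjoin_le_of_algebraMap_mem _ hbase
      (by rintro _ ⟨⟨t, b⟩, s, hs, rfl⟩; exact hn t b s hs) hv
  have hvar : ∀ n, ∀ t b s, Multiset.card s ≤ n → lieVar (t, b) s ∈ S := by
    intro n
    induction n with
    | zero =>
      intro t b s hs
      obtain rfl := Multiset.card_eq_zero.1 (Nat.le_zero.1 hs)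
      exact (mem_S _).2 fun i => hmax t b 0 i (by simp)
    | succ n ih =>
      intro t b s hs
      rcases s.eq_zero_or_exists_max_cons with rfl | ⟨l, s, rfl, hl⟩
      · exact ih t b 0 (by simp)
      rw [Multiset.card_cons, add_le_add_iff_right] at hs
      refine (mem_S _).2 fun i => ?_
      rcases le_or_gt l i with hi | hi
      · refine hmax t b _ i fun b hb => ?_
        rcases Multiset.mem_cons.1 hb with rfl | hb
        exacts [hi, (hl b hb).trans hi]
      have hv := (mem_S _).1 (ih t b s hs)
      -- As in `polyPair_lie_step`, `∂_i X_s` splits into `X_{is}`, dominated by `l`, and a part of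
      -- lower order.
      have hrel : ψ (E.del l (E.del i (lieVar (t, b) s))) =
          EA.fst.del l (ψ (E.del i (lieVar (t, b) s))) := by
        have hw : E.del i (lieVar (t, b) s) - lieVar (t, b) (i ::ₘ s) ∈ _ :=
          lieStructure_del_sub_mem (EK := EK.fst) (c := Γ.c₁) (t, b) s i
        rw [← add_sub_cancel (lieVar (t, b) (i ::ₘ s)) (E.del i (lieVar (t, b) s))]
        simp only [OperatorStructure.del_add, map_add]
        congr 1
        · refine hmax t b _ l fun b hb => ?_
          rcases Multiset.mem_cons.1 hb with rfl | hb
          exacts [hi.le, hl b hb]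
        · exact (mem_S _).1 (hext n ih _ (orderLE_mono hs hw)) l
      rw [show E.del i (lieVar (t, b) (l ::ₘ s)) = E.del l (E.del i (lieVar (t, b) s)) +
          ∑ ℓ, Γ.c₁ ℓ i l • E.del ℓ (lieVar (t, b) s) from lieStructure_del_cons _ hl hi,
        ← (show E.del l (lieVar (t, b) s) = lieVar (t, b) (l ::ₘ s) from
          lieStructure_del_max _ hl), hv l, (hA _).lie i l, map_add, map_sum, hrel, hv i]
      simp only [AlgHom.map_smul_of_tower, hv]
  refine (mem_S v).1 ?_ i
  have hv : v ∈ Algebra.adjoin K (Set.range MvPolynomial.X) := by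
    rw [MvPolynomial.adjoin_range_X]; trivial
  refine Algebra.adjoin_le_of_algebraMap_mem _ hbase ?_ hv
  rintro _ ⟨⟨⟨t, b⟩, s⟩, rfl⟩
  exact hvar _ t b s le_rfl

include hKA in
theorem evalAt_snd [IsScalarTower k F K] [IsScalarTower k F A] (hΓ : Γ.IsJacobiAssociative EF)
    (hFK : EF.IsAlgebraOver EK) (hA : ∀ x, Γ.CommutesAt EA x) (a : ι → A)
    (v : OpPoly 𝒟₁ 𝒟₂ ι K) (j : Fin 𝒟₂.m) :
    EA.evalAt a K ((Γ.polyPair EK ι).snd.del j v) = EA.snd.del j (EA.evalAt a K v) := by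
  set E := (Γ.polyPair EK ι).snd with hE
  set ψ := EA.evalAt a K with hψ
  set S := homSubalgebra E EA.snd (ψ.restrictScalars k) with hS
  have mem_S : ∀ v, v ∈ S ↔ ∀ i, ψ (E.del i v) = EA.snd.del i (ψ v) :=
    fun v => mem_homSubalgebra
  have hbase : ∀ f : K, algebraMap K _ f ∈ S := by
    refine fun f => (mem_S _).2 fun i => ?_
    have h1 : E.del i (algebraMap K _ f) = _ := polyPair_snd_extends i f
    rw [h1, AlgHom.commutes, AlgHom.commutes, hKA.snd_extends]
  have hext : EA.fst.Extends EF.fst := hKA.fst_extends.trans hFK.fst_extends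
  have hiter : ∀ j s x, EA.snd.del j (EA.fst.multiIter s x) =
      EA.fst.multiIter s (EA.snd.del j x) := fun j s x =>
    OperatorStructure.multiIter_comm (fun i x => (hA x).mixed i j) s x
  have hv : v ∈ Algebra.adjoin K (Set.range MvPolynomial.X) := by
    rw [MvPolynomial.adjoin_range_X]; trivial
  refine (mem_S v).1 (Algebra.adjoin_le_of_algebraMap_mem _ hbase ?_ hv) j
  rintro _ ⟨⟨⟨t, _ | l⟩, s⟩, rfl⟩
  · refine (mem_S _).2 fun j => ?_
    rw [hE, polyPair_snd_del_none, hψ, EA.evalAt_lieVar, EA.evalAt_lieVar]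
    exact (hiter j s _).symm
  · refine (mem_S _).2 fun j => ?_
    rw [hE, polyPair_snd_del_some, map_sum, hψ, EA.evalAt_lieVar]
    simp only [AlgHom.map_smul_of_tower, EA.evalAt_lieVar]
    change ∑ ℓ, Γ.c₂ ℓ j l • EA.fst.multiIter s (EA.snd.del ℓ (a t)) =
      EA.snd.del j (EA.fst.multiIter s (EA.snd.del l (a t)))
    rw [hiter, (hA _).hs, OperatorStructure.multiIter_sum]
    -- Multiplication by `c₂` commutes with the Lie iterates, because `c₂` is constant for them.
    exact Finset.sum_congr rfl fun ℓ _ => OperatorStructure.multiIter_comm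
      (φ := fun x => Γ.c₂ ℓ j l • x)
      (fun i x => (hext.del_smul_const i (fun p => hΓ.fst_const p _ _ _) x).symm) s _

end Universal

section PolynomialRing

variable {k : Type*} [Field k]
  {D₁ : Type*} [CommRing D₁] [Algebra k D₁] [IsLocalRing D₁]
  {D₂ : Type*} [CommRing D₂] [Algebra k D₂] [IsLocalRing D₂]
  {𝒟₁ : LocalOperatorSystem k D₁} {𝒟₂ : LocalOperatorSystem k D₂}
  {F : Type*} [Field F] [Algebra k F] {K : Type*} [Field K] [Algebra k K] [Algebra F K]
  {ι : Type*} {Γ : LHSSystem 𝒟₁ 𝒟₂ F} {EF : PairStructure 𝒟₁ 𝒟₂ F}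
  {EK : PairStructure 𝒟₁ 𝒟₂ K}

theorem polyPair_isPolynomialRing [IsScalarTower k F K] (hΓ : Γ.IsJacobiAssociative EF)
    (hFK : EF.IsAlgebraOver EK) (hK : Γ.Commutes EK) :
    IsPolynomialRing.{w} Γ EK (Γ.polyPair EK ι) fun t : ι => lieVar (t, none) 0 := by
  refine ⟨polyPair_isAlgebraOver, (Γ.commutes_iff _).2 (polyPair_commutesAt hΓ hFK hK), ?_⟩
  intro A _ _ _ _ _ _ _ EA hKA hA a
  rw [Γ.commutes_iff] at hA
  refine ⟨EA.evalAt a K, ⟨(PairStructure.isHom_iff _ _ _).2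
    ⟨fun i v => evalAt_fst hKA hA a v i, fun j v => evalAt_snd hKA hΓ hFK hA a v j⟩,
    fun t => ?_⟩, ?_⟩
  · rw [EA.evalAt_lieVar]; simp [PairStructure.varValue]
  · rintro ψ ⟨hψ, ha⟩
    refine MvPolynomial.algHom_ext fun ⟨⟨t, b⟩, s⟩ => ?_
    rw [EA.evalAt_lieVar]
    refine (polyPair_hom_lieVar hψ t b s).trans ?_
    congr 1
    exact funext ha

theorem IsPolynomialRing.of_algEquiv {P B : Type*} [CommRing P] [Algebra k P] [Algebra F P]
    [Algebra K P] [IsScalarTower k F P] [IsScalarTower k K P] [IsScalarTower F K P]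
    [CommRing B] [Algebra k B] [Algebra F B]
    [Algebra K B] [IsScalarTower k F B] [IsScalarTower k K B] [IsScalarTower F K B]
    {EP : PairStructure 𝒟₁ 𝒟₂ P} {EB : PairStructure 𝒟₁ 𝒟₂ B} {x : ι → P}
    (h : IsPolynomialRing.{w} Γ EK EP x) (f : P ≃ₐ[K] B)
    (hf : EP.IsHom EB (f.restrictScalars k : P →ₐ[k] B)) :
    IsPolynomialRing.{w} Γ EK EB fun t => f (x t) := by
  obtain ⟨h1, h2, h3⟩ := h
  refine ⟨?_, ?_, ?_⟩
  · have := hf.comp h1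
    rwa [show (f.restrictScalars k : P →ₐ[k] B).comp (IsScalarTower.toAlgHom k K P) =
      IsScalarTower.toAlgHom k K B from AlgHom.ext fun a => f.commutes a] at this
  · rw [Γ.commutes_iff] at h2 ⊢
    intro b
    obtain ⟨p, rfl⟩ := f.surjective b
    exact (h2 p).map hf fun c p => (f : P →ₐ[K] B).map_smul_of_tower c p
  · intro A _ _ _ _ _ _ _ EA hKA hA a
    obtain ⟨ψ, ⟨hψ, ha⟩, huniq⟩ := h3 A EA hKA hA a
    have hs : EB.IsHom EP ((f.symm : B →ₐ[K] P).restrictScalars k) :=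
      PairStructure.IsHom.symm (f := f.restrictScalars k) hf
    have hc := hψ.comp hs
    refine ⟨ψ.comp (f.symm : B →ₐ[K] P), ⟨hc, fun t => ?_⟩, ?_⟩
    · change ψ (f.symm (f (x t))) = a t
      rw [f.symm_apply_apply, ha]
    · rintro ψ' ⟨hψ', ha'⟩
      have hc' := hψ'.comp hf
      rw [← huniq (ψ'.comp (f : P →ₐ[K] B)) ⟨hc', ha'⟩]
      refine AlgHom.ext fun b => ?_
      change ψ' b = ψ' (f (f.symm b))
      rw [f.apply_symm_apply]

end PolynomialRing

/-! ### Extension to the fraction field -/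

section Fraction

variable {k : Type*} [Field k]
  {D : Type*} [CommRing D] [Algebra k D] [IsLocalRing D] {𝒟 : LocalOperatorSystem k D}
  {D₁ : Type*} [CommRing D₁] [Algebra k D₁] [IsLocalRing D₁]
  {D₂ : Type*} [CommRing D₂] [Algebra k D₂] [IsLocalRing D₂]
  {𝒟₁ : LocalOperatorSystem k D₁} {𝒟₂ : LocalOperatorSystem k D₂}
  {P : Type*} [CommRing P] [Algebra k P]
  {L : Type*} [Field L] [Algebra k L] [Algebra P L] [IsScalarTower k P L] [IsFractionRing P L]

/-- The homomorphism underlying the extension of an operator structure to the fraction field. -/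
def fractionHom (E : OperatorStructure 𝒟 P) (L : Type*) [Field L] [Algebra k L] [Algebra P L]
    [IsScalarTower k P L] [IsFractionRing P L] : L →ₐ[k] D ⊗[k] L :=
  IsLocalization.liftAlgHom (M := nonZeroDivisors P)
    (f := (baseMap D (IsScalarTower.toAlgHom k P L)).comp E.e) fun p => by
      -- The residue of the image of `p` is `p` itself, which is invertible in `L`.
      refine 𝒟.isUnit_of_isUnit_πBase ?_
      rw [AlgHom.comp_apply, E.e_eq, 𝒟.baseMap_expand, 𝒟.πBase_expand]
      exact IsLocalization.map_units L p

theorem fractionHom_algebraMap (E : OperatorStructure 𝒟 P) (p : P) :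
    fractionHom E L (algebraMap P L p) = baseMap D (IsScalarTower.toAlgHom k P L) (E.e p) :=
  IsLocalization.lift_eq _ _

/-- The extension of an operator structure to the fraction field. -/
def OperatorStructure.fraction (E : OperatorStructure 𝒟 P) (L : Type*) [Field L] [Algebra k L]
    [Algebra P L] [IsScalarTower k P L] [IsFractionRing P L] : OperatorStructure 𝒟 L where
  e := fractionHom E L
  residue_comp := by
    refine IsLocalization.algHom_ext (nonZeroDivisors P) (AlgHom.ext fun p => ?_)
    change 𝒟.πBase L (fractionHom E L (algebraMap P L p)) = algebraMap P L p
    rw [fractionHom_algebraMap, E.e_eq, 𝒟.baseMap_expand, 𝒟.πBase_expand]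
    rfl

/-- The extension of a pair of operator structures to the fraction field. -/
def PairStructure.fraction (E : PairStructure 𝒟₁ 𝒟₂ P) (L : Type*) [Field L] [Algebra k L]
    [Algebra P L] [IsScalarTower k P L] [IsFractionRing P L] : PairStructure 𝒟₁ 𝒟₂ L :=
  ⟨E.fst.fraction L, E.snd.fraction L⟩

theorem PairStructure.isHom_fraction (E : PairStructure 𝒟₁ 𝒟₂ P) :
    E.IsHom (E.fraction L) (IsScalarTower.toAlgHom k P L) :=
  ⟨AlgHom.ext fun p => (fractionHom_algebraMap E.fst p).symm,
    AlgHom.ext fun p => (fractionHom_algebraMap E.snd p).symm⟩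

/-- Each relation equates two algebra homomorphisms out of a localization of `P`, so it need only be
checked on `P`. -/
theorem LHSSystem.Commutes.fraction {F : Type*} [Field F] [Algebra k F] [Algebra F P]
    [IsScalarTower k F P] [Algebra F L] [IsScalarTower k F L] [IsScalarTower F P L]
    {Γ : LHSSystem 𝒟₁ 𝒟₂ F} {E : PairStructure 𝒟₁ 𝒟₂ P} (h : Γ.Commutes E) :
    Γ.Commutes (E.fraction L) := by
  have hL : ∀ p, Γ.CommutesAt (E.fraction L) (algebraMap P L p) := fun p =>
    ((Γ.commutes_iff E).1 h p).map E.isHom_fraction fun f x =>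
      _root_.map_smul (IsScalarTower.toAlgHom F P L) f x
  refine ⟨?_, ?_, ?_⟩
  · exact IsLocalization.algHom_ext (nonZeroDivisors P) <| AlgHom.ext fun p =>
      (lie_commute_iff Γ.lie _ _).2 (hL p).lie
  · exact IsLocalization.algHom_ext (nonZeroDivisors P) <| AlgHom.ext fun p =>
      (hs_commute_iff Γ.hs _ _).2 (hL p).hs
  · exact IsLocalization.algHom_ext (nonZeroDivisors P) <| AlgHom.ext fun p =>
      (mixed_commute_iff F _ _ _).2 (hL p).mixed

end Fraction

/-! ### Ordered indices -/

section OrderedIndex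

variable {k : Type*} [Field k]
  {D₁ : Type*} [CommRing D₁] [Algebra k D₁] [IsLocalRing D₁]
  {D₂ : Type*} [CommRing D₂] [Algebra k D₂] [IsLocalRing D₂]
  {𝒟₁ : LocalOperatorSystem k D₁} {𝒟₂ : LocalOperatorSystem k D₂}

/-- The predicate that cuts out the ordered indices. -/
def IsOrdered (ξ : List (OpIndex 𝒟₁ 𝒟₂)) : Prop :=
  ξ.Pairwise (fun i j => i ≥ j) ∧ ξ.countP (fun i => (ofLex i).isLeft) ≤ 1

/-- The multiset of the entries of Lie type. -/
def liePart : List (OpIndex 𝒟₁ 𝒟₂) → Multiset (Fin 𝒟₁.m)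
  | [] => 0
  | i :: ξ => Sum.elim (fun _ => liePart ξ) (fun l => l ::ₘ liePart ξ) (ofLex i)

/-- The first entry of HS-type, if there is one. -/
def hsPart : List (OpIndex 𝒟₁ 𝒟₂) → Option (Fin 𝒟₂.m)
  | [] => none
  | i :: ξ => Sum.elim (fun j => some j) (fun _ => hsPart ξ) (ofLex i)

theorem mem_liePart {ξ : List (OpIndex 𝒟₁ 𝒟₂)} {l : Fin 𝒟₁.m} (h : l ∈ liePart ξ) :
    toLex (Sum.inr l) ∈ ξ := by
  induction ξ with
  | nil => simp [liePart] at h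
  | cons i ξ ih =>
    obtain ⟨j | j, rfl⟩ := toLex.surjective i
    · exact List.mem_cons_of_mem _ (ih h)
    · rcases Multiset.mem_cons.1 h with rfl | h
      · exact List.mem_cons_self
      · exact List.mem_cons_of_mem _ (ih h)

theorem IsOrdered.tail {i : OpIndex 𝒟₁ 𝒟₂} {ξ : List (OpIndex 𝒟₁ 𝒟₂)} (h : IsOrdered (i :: ξ)) :
    IsOrdered ξ :=
  ⟨(List.pairwise_cons.1 h.1).2, (List.sublist_cons_self i ξ).countP_le.trans h.2⟩

theorem IsOrdered.liePart_le {l : Fin 𝒟₁.m} {ξ : List (OpIndex 𝒟₁ 𝒟₂)}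
    (h : IsOrdered (toLex (Sum.inr l) :: ξ)) : ∀ b ∈ liePart ξ, b ≤ l := fun _ hb =>
  Sum.Lex.inr_le_inr_iff.1 ((List.pairwise_cons.1 h.1).1 _ (mem_liePart hb))

/-- Lie entries exceed HS entries, so none can follow in a decreasing list, and a second HS entry is
excluded by the count. -/
theorem IsOrdered.eq_nil {j : Fin 𝒟₂.m} {ξ : List (OpIndex 𝒟₁ 𝒟₂)}
    (h : IsOrdered (toLex (Sum.inl j) :: ξ)) : ξ = [] := by
  refine List.eq_nil_iff_forall_not_mem.2 fun i hi => ?_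
  have h2 := h.2
  rw [List.countP_cons_of_pos (by rfl)] at h2
  have h0 : ξ.countP (fun i => (ofLex i).isLeft) = 0 := by omega
  have hle := (List.pairwise_cons.1 h.1).1 i hi
  obtain ⟨l | l, rfl⟩ := toLex.surjective i
  · exact (List.countP_eq_zero.1 h0 _ hi) rfl
  · exact Sum.Lex.not_inr_le_inl hle

theorem IsOrdered.eq_append {ξ : List (OpIndex 𝒟₁ 𝒟₂)} (h : IsOrdered ξ) :
    ξ = ((liePart ξ).sort (· ≥ ·)).map (fun l => toLex (Sum.inr l)) ++
      (hsPart ξ).toList.map (fun j => toLex (Sum.inl j)) := by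
  induction ξ with
  | nil => simp [liePart, hsPart]
  | cons i ξ ih =>
    obtain ⟨j | l, rfl⟩ := toLex.surjective i
    · rw [h.eq_nil]; simp [liePart, hsPart]
    · have h1 : liePart (toLex (Sum.inr l) :: ξ) = l ::ₘ liePart ξ := rfl
      have h2 : hsPart (toLex (Sum.inr l) :: ξ) = hsPart ξ := rfl
      rw [h1, h2, Multiset.sort_cons l _ (· ≥ ·) h.liePart_le, List.map_cons, List.cons_append,
        ← ih h.tail]

theorem orderedIndex_injective :
    Function.Injective fun ξ : OrderedIndex 𝒟₁ 𝒟₂ => (hsPart ξ.1, liePart ξ.1) := by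
  intro ξ η h
  obtain ⟨h1, h2⟩ := Prod.mk.inj h
  refine Subtype.ext ?_
  rw [IsOrdered.eq_append ξ.2, IsOrdered.eq_append η.2, h1, h2]

/-- In an ordered iterate each Lie operator dominates those already applied, so no correction ever
arises and the result is a single variable. -/
theorem polyPair_iter {F : Type*} [Field F] {K : Type*} [Field K] [Algebra k K]
    [Algebra k F] [Algebra F K] {ι : Type*} {Γ : LHSSystem 𝒟₁ 𝒟₂ F} {EK : PairStructure 𝒟₁ 𝒟₂ K}
    (t : ι) {ξ : List (OpIndex 𝒟₁ 𝒟₂)} (h : IsOrdered ξ) :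
    (Γ.polyPair EK ι).iter ξ (lieVar (t, none) 0) = lieVar (t, hsPart ξ) (liePart ξ) := by
  induction ξ with
  | nil => rfl
  | cons i ξ ih =>
    change (Γ.polyPair EK ι).op i ((Γ.polyPair EK ι).iter ξ (lieVar (t, none) 0)) = _
    obtain ⟨j | l, rfl⟩ := toLex.surjective i
    · rw [h.eq_nil]
      exact polyPair_snd_del_none t 0 j
    · rw [ih h.tail]
      exact lieStructure_del_max _ h.liePart_le

end OrderedIndex

/-! ### The generic extension -/

section Generic

variable {k : Type*} [Field k]
  {D₁ : Type*} [CommRing D₁] [Algebra k D₁] [IsLocalRing D₁]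
  {D₂ : Type*} [CommRing D₂] [Algebra k D₂] [IsLocalRing D₂]
  {𝒟₁ : LocalOperatorSystem k D₁} {𝒟₂ : LocalOperatorSystem k D₂}
  {F : Type*} [Field F] [Algebra k F] {K : Type*} [Field K] [Algebra k K] [Algebra F K]
  {ι : Type*} {Γ : LHSSystem 𝒟₁ 𝒟₂ F} {EF : PairStructure 𝒟₁ 𝒟₂ F} {EK : PairStructure 𝒟₁ 𝒟₂ K}

/-- The coefficient of a variable, as an `F`-linear map. -/
def varCoeff (F : Type*) [Field F] {K : Type*} [Field K] [Algebra F K] {σ : Type*} (q : σ) :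
    MvPolynomial σ K →ₗ[F] K :=
  (MvPolynomial.lcoeff K (Finsupp.single q 1)).restrictScalars F

theorem varCoeff_X {σ : Type*} [DecidableEq σ] (p q : σ) :
    varCoeff F q (MvPolynomial.X p : MvPolynomial σ K) = if p = q then 1 else 0 := by
  classical
  change MvPolynomial.coeff (Finsupp.single q 1) (MvPolynomial.X p) = _
  rw [MvPolynomial.coeff_X]
  congr 1
  rw [eq_iff_iff, Finsupp.single_left_inj one_ne_zero]

theorem pair_inj {m : ℕ} {p q : {p : Fin m × Fin m // p.1 ≤ p.2}} :
    p.1.1 ::ₘ {p.1.2} = q.1.1 ::ₘ ({q.1.2} : Multiset (Fin m)) ↔ p = q := by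
  refine ⟨fun h => ?_, fun h => by rw [h]⟩
  obtain ⟨⟨a, b⟩, hab⟩ := p
  obtain ⟨⟨c, d⟩, hcd⟩ := q
  have h' : a = c ∧ b = d := by
    rcases Multiset.cons_eq_cons.1 h with ⟨rfl, h⟩ | ⟨hne, s, h1, h2⟩
    · exact ⟨rfl, Multiset.singleton_inj.1 h⟩
    · have hbc : b = c := ((Multiset.singleton_eq_cons_iff _).1 h1).1
      have hda : d = a := ((Multiset.singleton_eq_cons_iff _).1 h2).1
      have hab' : a ≤ b := hab
      have hcd' : c ≤ d := hcd
      exact absurd (le_antisymm (hbc ▸ hab') (hda ▸ hcd')) hne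
  exact Subtype.ext (Prod.ext h'.1 h'.2)

/-- At `x_t` the operators yield distinct variables, except that `∂_i ∂_j` with `i < j` also
contributes a combination of the `X_ℓ`. The system is triangular: coefficients of the second-order
variables are compared before those of the `X_ℓ`. -/
theorem polyPair_lowOperators_linearIndependent (hΓ : Γ.IsJacobiAssociative EF) (t : ι) :
    LinearIndependent F fun a =>
      lowOperators (Γ.polyPair EK ι) a (lieVar (t, none) 0) := by
  classical
  have h0 : ∀ b i, (Γ.polyPair EK ι).fst.del i (lieVar (t, b) 0) = lieVar (t, b) {i} :=
    fun b i => lieStructure_del_max _ (by simp)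
  have h1 : ∀ p : {p : Fin 𝒟₁.m × Fin 𝒟₁.m // p.1 ≤ p.2},
      (Γ.polyPair EK ι).fst.del p.1.1 (lieVar (t, none) {p.1.2}) =
        lieVar (t, none) {p.1.1, p.1.2} +
          ∑ ℓ, Γ.c₁ ℓ p.1.1 p.1.2 • lieVar (t, none) {ℓ} := by
    rintro ⟨⟨i, j⟩, hij⟩
    rcases eq_or_lt_of_le hij with h | h
    · obtain rfl : i = j := h
      simp only [hΓ.jacobi.diag, zero_smul, Finset.sum_const_zero, add_zero]
      exact lieStructure_del_max _ (by simp)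
    · have h2 : ∀ b ∈ ({i} : Multiset (Fin 𝒟₁.m)), b ≤ j := by simpa using h.le
      have h3 := lieStructure_del_cons (EK := EK.fst) (c := Γ.c₁) (t, (none : Option (Fin 𝒟₂.m)))
        (s := 0) (by simp) h
      have h4 := lieStructure_del_max (EK := EK.fst) (c := Γ.c₁)
        (t, (none : Option (Fin 𝒟₂.m))) h2
      change (Γ.polyPair EK ι).fst.del i (lieVar (t, none) {j}) =
        (Γ.polyPair EK ι).fst.del j ((Γ.polyPair EK ι).fst.del i (lieVar (t, none) 0)) +
          ∑ ℓ, Γ.c₁ ℓ i j • (Γ.polyPair EK ι).fst.del ℓ (lieVar (t, none) 0) at h3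
      change (Γ.polyPair EK ι).fst.del j (lieVar (t, none) {i}) = _ at h4
      simp only [h0] at h3
      rw [h3, h4, Multiset.pair_comm]
      rfl
  rw [Fintype.linearIndependent_iff]
  intro g hg
  simp only [Fintype.sum_sum_type, lowOperators, Function.comp_apply, h0, h1,
    polyPair_snd_del_none] at hg
  have hq := fun q => congrArg (varCoeff F q) hg
  simp only [map_add, map_sum, map_smul, varCoeff_X, map_zero] at hq
  have hpair : ∀ p, g (Sum.inr (Sum.inl p)) = 0 := by
    intro p
    have h := hq ((t, none), {p.1.1, p.1.2})
    simpa [pair_inj, smul_eq_zero] using h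
  have hmixed : ∀ p, g (Sum.inr (Sum.inr p)) = 0 := by
    intro p
    have h := hq ((t, some p.2), {p.1})
    have h2 : ∀ x : Fin 𝒟₁.m × Fin 𝒟₂.m, x.2 = p.2 ∧ x.1 = p.1 ↔ x = p := fun x => by
      rw [Prod.ext_iff, and_comm]
    simpa [h2, smul_eq_zero] using h
  have hfst : ∀ i, g (Sum.inl (Sum.inl i)) = 0 := by
    intro i
    have h := hq ((t, none), {i})
    simpa [hpair, smul_eq_zero] using h
  have hsnd : ∀ i, g (Sum.inl (Sum.inr i)) = 0 := by
    intro i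
    have h := hq ((t, some i), 0)
    simpa using h
  rintro ((i | i) | p | p)
  exacts [hfst i, hsnd i, hpair p, hmixed p]

variable {L : Type*} [Field L] [Algebra k L] [Algebra (OpPoly 𝒟₁ 𝒟₂ ι K) L]
  [IsScalarTower k (OpPoly 𝒟₁ 𝒟₂ ι K) L] [IsFractionRing (OpPoly 𝒟₁ 𝒟₂ ι K) L]

/-- The extension of the operators to the rational function field. -/
abbrev LHSSystem.genericPair (Γ : LHSSystem 𝒟₁ 𝒟₂ F) (EK : PairStructure 𝒟₁ 𝒟₂ K) (ι : Type*)
    (L : Type*) [Field L] [Algebra k L] [Algebra (OpPoly 𝒟₁ 𝒟₂ ι K) L]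
    [IsScalarTower k (OpPoly 𝒟₁ 𝒟₂ ι K) L] [IsFractionRing (OpPoly 𝒟₁ 𝒟₂ ι K) L] :
    PairStructure 𝒟₁ 𝒟₂ L :=
  (Γ.polyPair EK ι).fraction L

/-- The generic elements `x_t`. -/
def genericVar (𝒟₁ : LocalOperatorSystem k D₁) (𝒟₂ : LocalOperatorSystem k D₂) (K : Type*)
    [Field K] (L : Type*) [Field L] [Algebra (OpPoly 𝒟₁ 𝒟₂ ι K) L] (t : ι) : L :=
  algebraMap (OpPoly 𝒟₁ 𝒟₂ ι K) L (lieVar (t, none) 0)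

theorem genericPair_fst_del (i : Fin 𝒟₁.m) (p : OpPoly 𝒟₁ 𝒟₂ ι K) :
    (Γ.genericPair EK ι L).fst.del i (algebraMap _ L p) =
      algebraMap _ L ((Γ.polyPair EK ι).fst.del i p) :=
  (((PairStructure.isHom_iff _ _ _).1 (Γ.polyPair EK ι).isHom_fraction).1 i p).symm

theorem genericPair_snd_del (i : Fin 𝒟₂.m) (p : OpPoly 𝒟₁ 𝒟₂ ι K) :
    (Γ.genericPair EK ι L).snd.del i (algebraMap _ L p) =
      algebraMap _ L ((Γ.polyPair EK ι).snd.del i p) :=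
  (((PairStructure.isHom_iff _ _ _).1 (Γ.polyPair EK ι).isHom_fraction).2 i p).symm

theorem genericPair_isAlgebraOver [Algebra K L]
    [IsScalarTower K (OpPoly 𝒟₁ 𝒟₂ ι K) L]
    [IsScalarTower k K L] : EK.IsAlgebraOver (Γ.genericPair EK ι L) := by
  have h := (Γ.polyPair EK ι).isHom_fraction (L := L) |>.comp (polyPair_isAlgebraOver (Γ := Γ))
  rwa [show (IsScalarTower.toAlgHom k (OpPoly 𝒟₁ 𝒟₂ ι K) L).comp (IsScalarTower.toAlgHom k K _) =
    IsScalarTower.toAlgHom k K L from AlgHom.ext fun a =>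
      (IsScalarTower.algebraMap_apply K (OpPoly 𝒟₁ 𝒟₂ ι K) L a).symm] at h

theorem genericPair_commutes [IsScalarTower k F K] [Algebra F L]
    [IsScalarTower F (OpPoly 𝒟₁ 𝒟₂ ι K) L]
    [IsScalarTower k F L] (hΓ : Γ.IsJacobiAssociative EF) (hFK : EF.IsAlgebraOver EK)
    (hK : Γ.Commutes EK) : Γ.Commutes (Γ.genericPair EK ι L) :=
  ((Γ.commutes_iff _).2 (polyPair_commutesAt hΓ hFK hK)).fraction

theorem genericPair_algebraicIndependent [Algebra K L]
    [IsScalarTower K (OpPoly 𝒟₁ 𝒟₂ ι K) L] :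
    AlgebraicIndependent K fun p : ι × OrderedIndex 𝒟₁ 𝒟₂ =>
      (Γ.genericPair EK ι L).iter p.2.1 (genericVar 𝒟₁ 𝒟₂ K L p.1) := by
  have hX : AlgebraicIndependent K fun q : (ι × Option (Fin 𝒟₂.m)) × Multiset (Fin 𝒟₁.m) =>
      algebraMap (OpPoly 𝒟₁ 𝒟₂ ι K) L (MvPolynomial.X q) :=
    (MvPolynomial.algebraicIndependent_X _ K).map'
      (f := IsScalarTower.toAlgHom K (OpPoly 𝒟₁ 𝒟₂ ι K) L) (IsFractionRing.injective _ L)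
  have h := hX.comp (fun p : ι × OrderedIndex 𝒟₁ 𝒟₂ => ((p.1, hsPart p.2.1), liePart p.2.1))
    fun p q h => by
      simp only [Prod.mk.injEq] at h
      exact Prod.ext h.1.1 (orderedIndex_injective (Prod.ext h.1.2 h.2))
  convert h using 1
  funext p
  refine ((Γ.polyPair EK ι).isHom_fraction.iter p.2.1 _).symm.trans ?_
  rw [polyPair_iter _ p.2.2]
  rfl

theorem genericPair_lowOperators_linearIndependent [Algebra F L]
    [IsScalarTower F (OpPoly 𝒟₁ 𝒟₂ ι K) L]
    (hΓ : Γ.IsJacobiAssociative EF) (t : ι) :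
    LinearIndependent F (lowOperators (Γ.genericPair EK ι L)) := by
  -- Evaluation at a generic element is linear, so independence of the values suffices.
  refine LinearIndependent.of_comp
    (LinearMap.proj (genericVar 𝒟₁ 𝒟₂ K L t) : (L → L) →ₗ[F] L) ?_
  have h := (polyPair_lowOperators_linearIndependent (EK := EK) hΓ t).map'
    (IsScalarTower.toAlgHom F (OpPoly 𝒟₁ 𝒟₂ ι K) L).toLinearMap
    (LinearMap.ker_eq_bot.2 (IsFractionRing.injective _ L))
  have heq : (LinearMap.proj (genericVar 𝒟₁ 𝒟₂ K L t) : (L → L) →ₗ[F] L) ∘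
      lowOperators (Γ.genericPair EK ι L) =
      (IsScalarTower.toAlgHom F (OpPoly 𝒟₁ 𝒟₂ ι K) L).toLinearMap ∘ fun a =>
        lowOperators (Γ.polyPair EK ι) a (lieVar (t, none) 0) := by
    funext a
    rcases a with (i | i) | p | p <;>
      simp [lowOperators, genericVar, genericPair_fst_del, genericPair_snd_del]
  rw [heq]
  exact h

/-- A set that is closed under the operators and contains the generic elements contains all
their derivatives. -/
theorem genericPair_lieVar_mem {S : Set L} (hS : ∀ t : ι, genericVar 𝒟₁ 𝒟₂ K L t ∈ S)
    (hop : ∀ i, ∀ a ∈ S, (Γ.genericPair EK ι L).op i a ∈ S) (t : ι) (b : Option (Fin 𝒟₂.m))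
    (s : Multiset (Fin 𝒟₁.m)) : algebraMap (OpPoly 𝒟₁ 𝒟₂ ι K) L (lieVar (t, b) s) ∈ S := by
  have hfst : ∀ i, ∀ p, algebraMap (OpPoly 𝒟₁ 𝒟₂ ι K) L p ∈ S →
      algebraMap _ L ((Γ.polyPair EK ι).fst.del i p) ∈ S := fun i p hp => by
    rw [← genericPair_fst_del]; exact hop (toLex (Sum.inr i)) _ hp
  have hsnd : ∀ i, ∀ p, algebraMap (OpPoly 𝒟₁ 𝒟₂ ι K) L p ∈ S →
      algebraMap _ L ((Γ.polyPair EK ι).snd.del i p) ∈ S := fun i p hp => by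
    rw [← genericPair_snd_del]; exact hop (toLex (Sum.inl i)) _ hp
  induction hn : Multiset.card s generalizing s with
  | zero =>
    obtain rfl := Multiset.card_eq_zero.1 hn
    rcases b with _ | j
    · exact hS t
    · have h := hsnd j _ (hS t)
      rwa [polyPair_snd_del_none] at h
  | succ n ih =>
    rcases s.eq_zero_or_exists_max_cons with rfl | ⟨l, s, rfl, hl⟩
    · simp at hn
    rw [Multiset.card_cons, add_left_inj] at hn
    have h := hfst l _ (ih s hn)
    rwa [show (Γ.polyPair EK ι).fst.del l (lieVar (t, b) s) = lieVar (t, b) (l ::ₘ s) from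
      lieStructure_del_max _ hl] at h

/-- The image of the polynomial ring is stable under the operators, and every variable in it is an
iterated derivative of a generic element. -/
theorem genericPair_algebraAdjoin [Algebra K L]
    [IsScalarTower K (OpPoly 𝒟₁ 𝒟₂ ι K) L] :
    (Γ.genericPair EK ι L).algebraAdjoin K (Set.range (genericVar (ι := ι) 𝒟₁ 𝒟₂ K L)) =
      (IsScalarTower.toAlgHom K (OpPoly 𝒟₁ 𝒟₂ ι K) L).range := by
  refine le_antisymm (sInf_le ⟨?_, ?_⟩) (le_sInf ?_)
  · rintro _ ⟨t, rfl⟩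
    exact ⟨lieVar (t, none) 0, rfl⟩
  · rintro i _ ⟨p, rfl⟩
    exact ⟨(Γ.polyPair EK ι).op i p, (Γ.polyPair EK ι).isHom_fraction.op i p⟩
  · rintro S ⟨hS, hop⟩ _ ⟨p, rfl⟩
    have hp : p ∈ Algebra.adjoin K (Set.range MvPolynomial.X) := by
      rw [MvPolynomial.adjoin_range_X]; trivial
    have hle : Algebra.adjoin K (Set.range MvPolynomial.X) ≤
        S.comap (IsScalarTower.toAlgHom K (OpPoly 𝒟₁ 𝒟₂ ι K) L) := by
      refine Algebra.adjoin_le ?_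
      rintro _ ⟨⟨⟨t, b⟩, s⟩, rfl⟩
      exact genericPair_lieVar_mem (fun t => hS ⟨t, rfl⟩) hop t b s
    exact hle hp

theorem genericPair_fieldAdjoin [Algebra K L]
    [IsScalarTower K (OpPoly 𝒟₁ 𝒟₂ ι K) L] :
    (Γ.genericPair EK ι L).fieldAdjoin K (Set.range (genericVar (ι := ι) 𝒟₁ 𝒟₂ K L)) = ⊤ := by
  refine eq_top_iff.2 (le_sInf ?_)
  rintro M ⟨hM, hop⟩ z -
  have hP : ∀ p, algebraMap (OpPoly 𝒟₁ 𝒟₂ ι K) L p ∈ M := by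
    intro p
    have h : (IsScalarTower.toAlgHom K (OpPoly 𝒟₁ 𝒟₂ ι K) L).range ≤ M.toSubalgebra := by
      rw [← genericPair_algebraAdjoin (Γ := Γ) (EK := EK)]
      exact sInf_le ⟨hM, hop⟩
    exact h ⟨p, rfl⟩
  obtain ⟨a, b, -, rfl⟩ := IsFractionRing.div_surjective (A := OpPoly 𝒟₁ 𝒟₂ ι K) z
  exact div_mem (hP a) (hP b)

/-- The set `X` is kept as a variable with an equation because the type of the subalgebra depends on
it; this permits `{y}` as well as a range. -/
theorem genericPair_exists_isPolynomialRing [IsScalarTower k F K] [Algebra K L]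
    [IsScalarTower K (OpPoly 𝒟₁ 𝒟₂ ι K) L]
    [Algebra F L]
    [IsScalarTower F (OpPoly 𝒟₁ 𝒟₂ ι K) L]
    [IsScalarTower k F L] [IsScalarTower k K L] [IsScalarTower F K L] (hΓ : Γ.IsJacobiAssociative EF)
    (hFK : EF.IsAlgebraOver EK) (hK : Γ.Commutes EK) {X : Set L}
    (hX : X = Set.range (genericVar (ι := ι) 𝒟₁ 𝒟₂ K L)) :
    ∃ (EP : PairStructure 𝒟₁ 𝒟₂ ((Γ.genericPair EK ι L).algebraAdjoin K X))
      (y' : ι → (Γ.genericPair EK ι L).algebraAdjoin K X),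
      (∀ t, (y' t : L) = genericVar 𝒟₁ 𝒟₂ K L t) ∧
      EP.IsHom (Γ.genericPair EK ι L)
        (((Γ.genericPair EK ι L).algebraAdjoin K X).val.restrictScalars k) ∧
      IsPolynomialRing.{w} Γ EK EP y' := by
  subst hX
  let f : OpPoly 𝒟₁ 𝒟₂ ι K ≃ₐ[K]
      (Γ.genericPair EK ι L).algebraAdjoin K (Set.range (genericVar (ι := ι) 𝒟₁ 𝒟₂ K L)) :=
    (AlgEquiv.ofInjective (IsScalarTower.toAlgHom K (OpPoly 𝒟₁ 𝒟₂ ι K) L)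
      (IsFractionRing.injective _ L)).trans
      (Subalgebra.equivOfEq _ _ genericPair_algebraAdjoin.symm)
  have hf : ∀ p, (f p : L) = algebraMap _ L p := fun p => rfl
  have hEP := (Γ.polyPair EK ι).isHom_transport (f.restrictScalars k)
  refine ⟨(Γ.polyPair EK ι).transport (f.restrictScalars k), fun t => f (lieVar (t, none) 0),
    fun t => rfl, (PairStructure.isHom_iff_op _ _ _).2 fun i b => ?_,
    (polyPair_isPolynomialRing hΓ hFK hK).of_algEquiv f hEP⟩
  obtain ⟨p, rfl⟩ := f.surjective b
  have h1 := hEP.op i p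
  change f ((Γ.polyPair EK ι).op i p) = _ at h1
  change (((Γ.polyPair EK ι).transport (f.restrictScalars k)).op i (f p) : L) =
    (Γ.genericPair EK ι L).op i (f p : L)
  rw [hf]
  refine (congrArg Subtype.val h1.symm).trans ?_
  exact (Γ.polyPair EK ι).isHom_fraction.op i p

end Generic

end

/-! ### The main theorem -/

theorem mainTheorem4
    {k : Type u₁} [Field k]
    {D₁ : Type u₂} [CommRing D₁] [Algebra k D₁] [IsLocalRing D₁]
    {D₂ : Type u₃} [CommRing D₂] [Algebra k D₂] [IsLocalRing D₂]
    (𝒟₁ : LocalOperatorSystem k D₁) (𝒟₂ : LocalOperatorSystem k D₂)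
    {F : Type u₄} [Field F] [Algebra k F] (EF : PairStructure 𝒟₁ 𝒟₂ F)
    (Γ : LHSSystem 𝒟₁ 𝒟₂ F) (hΓ : Γ.IsJacobiAssociative EF)
    {K : Type u} [Field K] [Algebra k K] [Algebra F K] [IsScalarTower k F K]
    (EK : PairStructure 𝒟₁ 𝒟₂ K) (hFK : EF.IsAlgebraOver EK) (hK : Γ.Commutes EK) :
    (∀ {E : Type v} [Field E] [Algebra K E] (x : E), Transcendental K x →
      ∃ (L : Type u) (_ : Field L) (_ : Algebra k L) (_ : Algebra F L) (_ : Algebra K L)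
        (_ : IsScalarTower k F L) (_ : IsScalarTower k K L) (_ : IsScalarTower F K L)
        (EL : PairStructure 𝒟₁ 𝒟₂ L) (φ : K⟮x⟯ →ₐ[K] L) (y : L),
        y = φ (IntermediateField.AdjoinSimple.gen K x) ∧
        EK.IsAlgebraOver EL ∧ Γ.Commutes EL ∧
        EL.fieldAdjoin K {y} = ⊤ ∧
        AlgebraicIndependent K (fun ξ : OrderedIndex 𝒟₁ 𝒟₂ => EL.iter ξ.1 y) ∧
        LinearIndependent F (lowOperators EL) ∧
        ∃ (EP : PairStructure 𝒟₁ 𝒟₂ (EL.algebraAdjoin K {y}))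
          (y' : EL.algebraAdjoin K {y}), (y' : L) = y ∧
          EP.IsHom EL ((EL.algebraAdjoin K {y}).val.restrictScalars k) ∧
          IsPolynomialRing.{w} Γ EK EP (fun _ : Unit => y')) ∧
    (∀ n : ℕ,
      ∃ (L : Type u) (_ : Field L) (_ : Algebra k L) (_ : Algebra F L) (_ : Algebra K L)
        (_ : IsScalarTower k F L) (_ : IsScalarTower k K L) (_ : IsScalarTower F K L)
        (EL : PairStructure 𝒟₁ 𝒟₂ L) (y : Fin n → L),
        EK.IsAlgebraOver EL ∧ Γ.Commutes EL ∧
        EL.fieldAdjoin K (Set.range y) = ⊤ ∧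
        AlgebraicIndependent K
          (fun p : Fin n × OrderedIndex 𝒟₁ 𝒟₂ => EL.iter p.2.1 (y p.1)) ∧
        ∃ (EP : PairStructure 𝒟₁ 𝒟₂ (EL.algebraAdjoin K (Set.range y)))
          (y' : Fin n → EL.algebraAdjoin K (Set.range y)), (∀ t, (y' t : L) = y t) ∧
          EP.IsHom EL ((EL.algebraAdjoin K (Set.range y)).val.restrictScalars k) ∧
          IsPolynomialRing.{w} Γ EK EP y') := by
  -- Both parts are instances of one construction, with `ι = Unit` and `ι = Fin n`. Linear
  -- independence is claimed only given an element of `ι`, since it is tested at a generic element.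
  have key : ∀ (ι : Type), ∃ (L : Type u) (_ : Field L) (_ : Algebra k L) (_ : Algebra F L)
      (_ : Algebra K L) (_ : IsScalarTower k F L) (_ : IsScalarTower k K L)
      (_ : IsScalarTower F K L) (EL : PairStructure 𝒟₁ 𝒟₂ L) (y : ι → L),
      EK.IsAlgebraOver EL ∧ Γ.Commutes EL ∧ EL.fieldAdjoin K (Set.range y) = ⊤ ∧
      AlgebraicIndependent K (fun p : ι × OrderedIndex 𝒟₁ 𝒟₂ => EL.iter p.2.1 (y p.1)) ∧
      (∀ _ : ι, LinearIndependent F (lowOperators EL)) ∧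
      ∀ X, X = Set.range y → ∃ (EP : PairStructure 𝒟₁ 𝒟₂ (EL.algebraAdjoin K X))
        (y' : ι → EL.algebraAdjoin K X), (∀ t, (y' t : L) = y t) ∧
        EP.IsHom EL ((EL.algebraAdjoin K X).val.restrictScalars k) ∧
        IsPolynomialRing.{w} Γ EK EP y' := fun ι =>
    ⟨FractionRing (OpPoly 𝒟₁ 𝒟₂ ι K), inferInstance, inferInstance, inferInstance, inferInstance,
      inferInstance, inferInstance, inferInstance, Γ.genericPair EK ι _, genericVar 𝒟₁ 𝒟₂ K _,
      genericPair_isAlgebraOver, genericPair_commutes hΓ hFK hK, genericPair_fieldAdjoin,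
      genericPair_algebraicIndependent, genericPair_lowOperators_linearIndependent hΓ,
      fun _ hX => genericPair_exists_isPolynomialRing hΓ hFK hK hX⟩
  refine ⟨fun {E} _ _ x hx => ?_, fun n => ?_⟩
  · obtain ⟨L, _, _, _, _, _, _, _, EL, y, h1, h2, h3, h4, h5, h6⟩ := key Unit
    have hy : Set.range y = {y ()} := Set.range_unique
    have h4' := h4.comp (fun ξ => ((), ξ)) fun _ _ h => (Prod.mk.inj h).2
    have htr : Transcendental K (y ()) :=
      -- The empty iterate puts `y` itself into the independent family.
      h4'.transcendental ⟨[], List.Pairwise.nil, Nat.zero_le _⟩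
    obtain ⟨EP, y', hy', hEP, hpoly⟩ := h6 _ hy.symm
    -- Both `x` and `y` are transcendental, so `K(x)` and `K(y)` are identified through the rational
    -- function field, with `x` sent to `y`.
    refine ⟨L, _, _, _, _, _, _, _, EL,
      (K⟮y ()⟯).val.comp (((RatFunc.algEquivOfTranscendental x hx).symm.trans
        (RatFunc.algEquivOfTranscendental (y ()) htr)) : K⟮x⟯ →ₐ[K] K⟮y ()⟯), y (), ?_,
      h1, h2, hy ▸ h3, h4', h5 (), EP, y' (), hy' (), hEP, hpoly⟩
    change y () = (RatFunc.algEquivOfTranscendental (y ()) htr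
      ((RatFunc.algEquivOfTranscendental x hx).symm (IntermediateField.AdjoinSimple.gen K x)) : L)
    rw [RatFunc.algEquivOfTranscendental_symm_gen, RatFunc.algEquivOfTranscendental_X]
  · obtain ⟨L, _, _, _, _, _, _, _, EL, y, h1, h2, h3, h4, -, h6⟩ := key (Fin n)
    exact ⟨L, _, _, _, _, _, _, _, EL, y, h1, h2, h3, h4, h6 _ rfl⟩
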